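/- Let $d\ge 1$, let $A$ be an Artinian local ring, let $S=\bigoplus_{\mathbf n\in\mathbb N^d}S_{\mathbf n}$ be a finitely generated standard $\mathbb N^d$-graded $A$-algebra (i.e. of finite type over $A$ and generated over $A$ by elements of total degree $1$), and let $M=\bigoplus_{\mathbf n\in\mathbb N^d}M_{\mathbf n}$ be a finitely generated $\mathbb N^d$-graded $S$-module. "For all large $\mathbf n$" means for all $\mathbf n\ge\mathbf n_0$ componentwise, for some $\mathbf n_0\in\mathbb N^d$. Let $P_M$ be the Hilbert polynomial of $M$, i.e. the polynomial over $\mathbb Q$ with $P_M(\mathbf n)=\ell_A(M_{\mathbf n})<\infty$ for all large $\mathbf n$, and let $e(M;\mathbf k)\in\mathbb Z$ ($\mathbf k\in\mathbb N^d$, almost all zero) be the coefficients in $$P_M(\mathbf n)=\sum_{\mathbf k\in\mathbb N^d}e(M;\mathbf k)\binom{\mathbf n+\mathbf k}{\mathbf k},\qquad \binom{\mathbf n+\mathbf k}{\mathbf k}=\prod_{i=1}^d\binom{n_i+k_i}{k_i};$$ both $P_M$ and the integers $e(M;\mathbf k)$ exist. The mixed multiplicity (of maximal degree) of $M$ of the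 type $\mathbf k$ is said to be defined, and is then $e(M;\mathbf k)$, if $e(M;\mathbf h)=0$ for all $\mathbf h\in\mathbb N^d$ with $\mathbf h\ge\mathbf k$ componentwise and $\mathbf h\ne\mathbf k$. Put $S_{++}=\bigoplus_{\mathbf n\ge(1,\dots,1)}S_{\mathbf n}$ and $S_j=S_{\mathbf e_j}$, where $\mathbf e_j$ is the $j$-th unit vector. For a finitely generated graded $S$-module $N$ let $\mathrm{Supp}_{++}N$ be the set of homogeneous prime ideals $P$ of $S$ with $P\not\supseteq S_{++}$ and $N_P\ne0$; its dimension is the supremum of the lengths of chains of primes in it, and $-\infty$ if it is empty. A homogeneous $a\in S$ is $S_{++}$-filter-regular with respect to $N$ if $(0:_N a)_{\mathbf n}=0$ for all large $\mathbf n$. A sequence $x_1,\dots,x_t$ of homogeneous elements of $S$ is an $S_{++}$-filter-regular sequence with respect to $M$ if each $x_i$ is $S_{++}$-filter-regular with respect to $M/(x_1,\dots,x_{i-1})M$; it is of the type $\mathbf k=(k_1,\dots,k_d)$ if it consists of $k_1$ elements of $S_1$, …, $k_d$ elements of $S_d$ (in any order). Suppose that the mixed multiplicity $e(M;\mathbf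 k)$ of $M$ of the type $\mathbf k$ is defined, and let $\mathbf x$ be an $S_{++}$-filter-regular sequence with respect to $M$ of the type $\mathbf k$. Then $$e(M;\mathbf k)=\ell_A\big[(M/\mathbf xM)_{\mathbf n}\big]\quad\text{for all large }\mathbf n,$$ and $e(M;\mathbf k)\ne0$ if and only if $\dim\mathrm{Supp}_{++}(M/\mathbf xM)=0$. -/

import Mathlib

open Filter

namespace MixedMult

section Ring

variable {d : ℕ} {A S : Type*} [CommRing A] [CommRing S] [Algebra A S]

/-- The graded `A`-algebra `S = ⨁ 𝒮 n` is a finitely generated standard `ℕ^d`-graded algebra: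
it is of finite type over `A` and generated over `A` by its elements of total degree one. -/
def IsStandard (𝒮 : (Fin d → ℕ) → Submodule A S) : Prop :=
  Algebra.FiniteType A S ∧
    Algebra.adjoin A (⋃ j : Fin d, (𝒮 (Pi.single j 1) : Set S)) = ⊤

/-- `S_{++} = ⨁_{n ≥ (1,…,1)} S_n`. -/
def plusPlus (𝒮 : (Fin d → ℕ) → Submodule A S) : Submodule A S :=
  ⨆ (n : Fin d → ℕ) (_ : 1 ≤ n), 𝒮 n

/-- `Proj S`: the homogeneous primes of `S` that do not contain `S_{++}`. -/
def projSet (𝒮 : (Fin d → ℕ) → Submodule A S) [GradedAlgebra 𝒮] : Set (PrimeSpectrum S) :=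
  {P | P.asIdeal.IsHomogeneous 𝒮 ∧ ¬ (plusPlus 𝒮 : Set S) ⊆ P.asIdeal}

/-- `Supp_{++} M = {P ∈ Proj S | M_P ≠ 0}`. -/
def suppPlusPlus (𝒮 : (Fin d → ℕ) → Submodule A S) [GradedAlgebra 𝒮]
    (M : Type*) [AddCommGroup M] [Module S M] : Set (PrimeSpectrum S) :=
  projSet 𝒮 ∩ Module.support S M

/-- `dim Supp_{++} M`: the supremum of the lengths of chains of primes in `Supp_{++} M`;
it is `⊥` (that is, `-∞`) when `Supp_{++} M` is empty. -/
noncomputable def dimSuppPlusPlus (𝒮 : (Fin d → ℕ) → Submodule A S) [GradedAlgebra 𝒮]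
    (M : Type*) [AddCommGroup M] [Module S M] : WithBot ℕ∞ :=
  Order.krullDim (suppPlusPlus 𝒮 M)

/-- `x` is a sequence of the type `k`: it consists of `k j` elements of
`S_j = S_{e_j}` for each `j`. -/
def IsOfType (𝒮 : (Fin d → ℕ) → Submodule A S) (k : Fin d → ℕ) {t : ℕ} (x : Fin t → S) : Prop :=
  ∃ c : Fin t → Fin d, (∀ i, x i ∈ 𝒮 (Pi.single (c i) 1)) ∧
    ∀ j, (Finset.univ.filter fun i => c i = j).card = k j

end Ring

section Hilbert

variable {d : ℕ} {A M : Type*} [CommRing A] [AddCommGroup M] [Module A M]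

/-- `P` is the Hilbert polynomial: `ℓ_A(M_n)` is finite and equal to `P(n)` for all large `n`. -/
def IsHilbertPolynomial (ℳ : (Fin d → ℕ) → Submodule A M) (P : MvPolynomial (Fin d) ℚ) : Prop :=
  ∀ᶠ n : Fin d → ℕ in atTop, ∃ l : ℕ,
    Module.length A (ℳ n) = l ∧ MvPolynomial.eval (fun i => (n i : ℚ)) P = l

open Classical in
/-- The Hilbert polynomial `P_M`. -/
noncomputable def hilbertPolynomial (ℳ : (Fin d → ℕ) → Submodule A M) :
    MvPolynomial (Fin d) ℚ :=
  if h : ∃ P, IsHilbertPolynomial ℳ P then h.choose else 0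

/-- `P(n) = ∑_k e(k) * binom(n + k, k)` with integers `e(k)`, almost all zero, where
`binom(n + k, k) = ∏_i binom(n_i + k_i, k_i)`. -/
def IsBinomialExpansion (P : MvPolynomial (Fin d) ℚ) (e : (Fin d → ℕ) →₀ ℤ) : Prop :=
  ∀ n : Fin d → ℕ, MvPolynomial.eval (fun i => (n i : ℚ)) P =
    e.sum fun k c => (c : ℚ) * ∏ i, ((n i + k i).choose (k i) : ℚ)

open Classical in
/-- The coefficients `e(M; k)` of the Hilbert polynomial in the binomial basis. -/
noncomputable def mixedCoeff (ℳ : (Fin d → ℕ) → Submodule A M) : (Fin d → ℕ) →₀ ℤ :=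
  if h : ∃ e, IsBinomialExpansion (hilbertPolynomial ℳ) e then h.choose else 0

/-- `e(M; k)` is the mixed multiplicity (of maximal degree) of `M` of the type `k`, i.e. the mixed
multiplicity of the type `k` is defined: `e(M; h) = 0` for all `h > k` (`h ≥ k` componentwise
and `h ≠ k`). -/
def IsMixedMultiplicityDefined (ℳ : (Fin d → ℕ) → Submodule A M) (k : Fin d → ℕ) : Prop :=
  ∀ h : Fin d → ℕ, k < h → mixedCoeff ℳ h = 0

end Hilbert

section FilterRegular

variable {d : ℕ} {A S M : Type*} [CommRing A] [CommRing S] [Algebra A S]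
  [AddCommGroup M] [Module S M] [Module A M] [IsScalarTower A S M]

/-- The grading of `M ⧸ N` by the images of the components of `M`. -/
def quotientGrading (ℳ : (Fin d → ℕ) → Submodule A M) (N : Submodule S M) :
    (Fin d → ℕ) → Submodule A (M ⧸ N) :=
  fun n => (ℳ n).map (N.mkQ.restrictScalars A)

/-- `a` is an `S_{++}`-filter-regular element with respect to `M`:
it is homogeneous and `(0 :_M a)_n = 0` for all large `n`. -/
def IsFilterRegularElement (𝒮 : (Fin d → ℕ) → Submodule A S)
    (ℳ : (Fin d → ℕ) → Submodule A M) (a : S) : Prop :=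
  SetLike.IsHomogeneousElem 𝒮 a ∧
    ∀ᶠ n : Fin d → ℕ in atTop, ∀ m ∈ ℳ n, a • m = 0 → m = 0

/-- `(s)M` for a set `s` of elements of `S`. -/
def spanSMul (M : Type*) [AddCommGroup M] [Module S M] (s : Set S) : Submodule S M :=
  Ideal.span s • (⊤ : Submodule S M)

/-- `x_1, …, x_t` is an `S_{++}`-filter-regular sequence with respect to `M`: each `x_i` is
`S_{++}`-filter-regular with respect to `M/(x_1, …, x_{i-1})M`. -/
def IsFilterRegularSequence (𝒮 : (Fin d → ℕ) → Submodule A S)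
    (ℳ : (Fin d → ℕ) → Submodule A M) {t : ℕ} (x : Fin t → S) : Prop :=
  ∀ i : Fin t, IsFilterRegularElement 𝒮
    (quotientGrading ℳ (spanSMul M (x '' Set.Iio i))) (x i)

end FilterRegular

end MixedMult

/-!
Everything is expressed through the family `e` of coefficients in the binomial basis. The backward
difference in the `j`-th variable sends `binom(n + k, k)` to `binom(n + k - e_j, k - e_j)`, hence it
translates the coefficients: `e(h)` is replaced by `e(h + e_j)` (`binomialSum_single_add_sub`). The
binomial functions are linearly independent even on large degrees
(`eq_zero_of_eventually_binomialSum_eq_zero`), so a function whose differences in all directions are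
eventually integral combinations of them is itself one (`isEventuallyBinomial_of_difference`).

The Hilbert polynomial exists by induction on a finite set `T` of generators of degree one, for
graded modules that are finite over the subalgebra generated by `T`
(`length_ne_top_and_isEventuallyBinomial`). A generator `a` of degree `e_j` controls the difference
of the Hilbert function in direction `j` through the kernel and the cokernel of multiplication by
`a`, which are finite over the subalgebra generated by `T ∖ {a}`. If some direction has no
generator, the components far out in that direction vanish.

If `a` is filter-regular of degree `e_j`, the kernel vanishes in large degrees and the Hilbert
function of `M/aM` is the backward difference of that of `M`. A filter-regular sequence of the type
`k` therefore translates the coefficients by `k`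
(`eventually_hilbertFun_filterRegularSequence`); if all coefficients above `k` vanish, what remains
is the constant `e(M; k)`.

For a graded module `N` whose Hilbert function is eventually a constant `c`, the condition `c ≠ 0`
is compared with `dim Supp_{++} N = 0` as follows
(`IsStandard.ne_zero_iff_dimSuppPlusPlus_eq_zero`). If the support is empty, a power of the product
of the ideals generated by the `S_{e_j}` annihilates `N`, so `N` vanishes in large degrees. Each
prime `P` in the support makes a shift of `S/P` a subquotient of `N`, and `S/P` is nonzero in every
degree. For `P < Q` in `Proj S`, multiplication by a homogeneous element of `Q` outside `P` is
injective but not surjective on the components of `S/P`, whose lengths are thus unbounded; so a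
constant Hilbert function excludes chains of positive length.
-/

namespace MixedMult

/-! ### Integral combinations of the functions `n ↦ binom(n + k, k)` -/

section Binomial

variable {d : ℕ}

/-- A property of large multidegrees may be tested after a translation. -/
lemma eventually_add_left_iff (u : Fin d → ℕ) {p : (Fin d → ℕ) → Prop} :
    (∀ᶠ n in atTop, p (u + n)) ↔ ∀ᶠ n in atTop, p n := by
  simp only [eventually_atTop]
  constructor
  · rintro ⟨a, ha⟩
    refine ⟨u + a, fun b hb => ?_⟩
    have h := ha (b - u) (le_tsub_of_add_le_left hb)
    rwa [add_tsub_cancel_of_le (le_self_add.trans hb)] at h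
  · rintro ⟨a, ha⟩
    exact ⟨a, fun b hb => ha _ (hb.trans le_add_self)⟩

lemma single_one_le {j : Fin d} {n : Fin d → ℕ} (h : 0 < n j) : Pi.single j 1 ≤ n := by
  intro i
  rcases eq_or_ne i j with rfl | hij
  · simpa using Nat.succ_le_of_lt h
  · simp [hij]

/-- `binom(n + k, k) = ∏_i binom(n_i + k_i, k_i)`. -/
def binomialFun (k n : Fin d → ℕ) : ℤ := ∏ i, ((n i + k i).choose (k i) : ℤ)

lemma binomialFun_zero (n : Fin d → ℕ) : binomialFun 0 n = 1 := by
  simp [binomialFun]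

/-- The value at `n` of `∑_k e(k) * binom(n + k, k)`, as a linear function of `e`. -/
noncomputable def binomialSum (n : Fin d → ℕ) : ((Fin d → ℕ) →₀ ℤ) →ₗ[ℤ] ℤ :=
  Finsupp.linearCombination ℤ fun k => binomialFun k n

lemma binomialSum_single (n k : Fin d → ℕ) (c : ℤ) :
    binomialSum n (Finsupp.single k c) = c * binomialFun k n := by
  simp [binomialSum]

/-- The translate `h ↦ e(h + u)` of a family of coefficients. -/
noncomputable def coeffShift (u : Fin d → ℕ) :
    ((Fin d → ℕ) →₀ ℤ) →ₗ[ℤ] ((Fin d → ℕ) →₀ ℤ) :=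
  Finsupp.lcomapDomain (fun h => h + u) (add_left_injective u)

lemma coeffShift_apply (u : Fin d → ℕ) (e : (Fin d → ℕ) →₀ ℤ) (h : Fin d → ℕ) :
    coeffShift u e h = e (h + u) := rfl

lemma coeffShift_add (u v : Fin d → ℕ) (e : (Fin d → ℕ) →₀ ℤ) :
    coeffShift (u + v) e = coeffShift u (coeffShift v e) := by
  ext h
  simp only [coeffShift_apply, add_assoc]

lemma binomialFun_single_add_of_eq_zero {j : Fin d} {k : Fin d → ℕ} (hk : k j = 0)
    (n : Fin d → ℕ) : binomialFun k (Pi.single j 1 + n) = binomialFun k n := by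
  refine Finset.prod_congr rfl fun i _ => ?_
  rcases eq_or_ne i j with rfl | hij
  · simp [hk]
  · simp [hij]

/-- Pascal's rule in the `j`-th variable. -/
lemma binomialFun_single_add_sub (j : Fin d) (k n : Fin d → ℕ) :
    binomialFun (k + Pi.single j 1) (Pi.single j 1 + n) - binomialFun (k + Pi.single j 1) n =
      binomialFun k (Pi.single j 1 + n) := by
  have hj := Finset.mem_univ j
  have pascal : (((1 + n j + (k j + 1)).choose (k j + 1) : ℕ) : ℤ)
      - ((n j + (k j + 1)).choose (k j + 1) : ℕ) = ((1 + n j + k j).choose (k j) : ℕ) := by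
    have : 1 + n j + (k j + 1) = (n j + k j + 1) + 1 := by ring
    rw [this, Nat.choose_succ_succ, show n j + (k j + 1) = n j + k j + 1 by ring,
      show 1 + n j + k j = n j + k j + 1 by ring]
    push_cast
    ring
  have rest : ∀ m m' l l' : Fin d → ℕ, (∀ i ≠ j, m i = m' i ∧ l i = l' i) →
      ∏ i ∈ Finset.univ.erase j, ((m i + l i).choose (l i) : ℤ) =
        ∏ i ∈ Finset.univ.erase j, ((m' i + l' i).choose (l' i) : ℤ) := by
    intro m m' l l' h
    refine Finset.prod_congr rfl fun i hi => ?_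
    rw [(h i (Finset.ne_of_mem_erase hi)).1, (h i (Finset.ne_of_mem_erase hi)).2]
  unfold binomialFun
  rw [← Finset.mul_prod_erase _ _ hj, ← Finset.mul_prod_erase _ _ hj,
    ← Finset.mul_prod_erase _ _ hj,
    rest (Pi.single j 1 + n) n (k + Pi.single j 1) k (fun i hi => by simp [hi]),
    rest n n (k + Pi.single j 1) k (fun i hi => by simp [hi]),
    rest (Pi.single j 1 + n) n k k (fun i hi => by simp [hi]), ← sub_mul]
  congr 1
  simpa using pascal

lemma coeffShift_single_of_eq_zero {j : Fin d} {k : Fin d → ℕ} (hk : k j = 0) (c : ℤ) :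
    coeffShift (Pi.single j 1) (Finsupp.single k c) = 0 := by
  ext h
  rw [coeffShift_apply, Finsupp.single_apply, if_neg]
  · rfl
  · rintro rfl
    simp at hk

lemma coeffShift_single_add (u k : Fin d → ℕ) (c : ℤ) :
    coeffShift u (Finsupp.single (k + u) c) = Finsupp.single k c := by
  ext h
  simp [coeffShift_apply, Finsupp.single_apply]

/-- The backward difference in the `j`-th variable lowers the `j`-th index by one. -/
lemma binomialSum_single_add_sub (j : Fin d) (n : Fin d → ℕ) (e : (Fin d → ℕ) →₀ ℤ) :
    binomialSum (Pi.single j 1 + n) e - binomialSum n e =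
      binomialSum (Pi.single j 1 + n) (coeffShift (Pi.single j 1) e) := by
  induction e using Finsupp.induction_linear with
  | zero => simp
  | add f g hf hg =>
    simp only [map_add, ← hf, ← hg]
    ring
  | single k c =>
    rcases Nat.eq_zero_or_pos (k j) with hk | hk
    · rw [coeffShift_single_of_eq_zero hk, map_zero, binomialSum_single, binomialSum_single,
        binomialFun_single_add_of_eq_zero hk, sub_self]
    · obtain ⟨k, rfl⟩ : ∃ k' : Fin d → ℕ, k = k' + Pi.single j 1 :=
        ⟨_, (tsub_add_cancel_of_le (single_one_le hk)).symm⟩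
      rw [coeffShift_single_add, binomialSum_single, binomialSum_single, binomialSum_single,
        ← mul_sub, binomialFun_single_add_sub]

lemma eventually_binomialSum_coeffShift_single {e : (Fin d → ℕ) →₀ ℤ}
    (he : ∀ᶠ n in atTop, binomialSum n e = 0) (j : Fin d) :
    ∀ᶠ n in atTop, binomialSum n (coeffShift (Pi.single j 1) e) = 0 := by
  rw [← eventually_add_left_iff (Pi.single j 1)]
  filter_upwards [he, (eventually_add_left_iff (Pi.single j 1)).2 he] with n h₁ h₂
  rw [← binomialSum_single_add_sub, h₁, h₂, sub_zero]

/-- Induction on multidegrees by unit steps. -/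
lemma induction_single_add {p : (Fin d → ℕ) → Prop} (zero : p 0)
    (step : ∀ j u, p u → p (Pi.single j 1 + u)) (u : Fin d → ℕ) : p u := by
  have key : ∀ (s : Finset (Fin d)) (v : Fin d → ℕ), p (∑ j ∈ s, Pi.single j (v j)) := by
    intro s v
    induction s using Finset.induction_on with
    | empty => simpa using zero
    | insert j s hj ih =>
      rw [Finset.sum_insert hj]
      generalize v j = m
      induction m with
      | zero => simpa using ih
      | succ m hm =>
        rw [show (Pi.single j (m + 1) : Fin d → ℕ) = Pi.single j 1 + Pi.single j m by
          rw [← Pi.single_add, add_comm], add_assoc]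
        exact step _ _ hm
  have h := key Finset.univ u
  rwa [Finset.univ_sum_single] at h

/-- The functions `binom(n + k, k)` are linearly independent, even on large `n`. -/
lemma eq_zero_of_eventually_binomialSum_eq_zero {e : (Fin d → ℕ) →₀ ℤ}
    (he : ∀ᶠ n in atTop, binomialSum n e = 0) : e = 0 := by
  by_contra hne
  obtain ⟨k, hk⟩ := e.support.exists_maximal (Finsupp.support_nonempty_iff.2 hne)
  have hshift : ∀ u, ∀ᶠ n in atTop, binomialSum n (coeffShift u e) = 0 := by
    refine induction_single_add ?_ fun j u hu => ?_
    · convert he using 4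
      ext h
      simp [coeffShift_apply]
    · rw [coeffShift_add]
      exact eventually_binomialSum_coeffShift_single hu j
  -- translating by a maximal index leaves only the constant term
  have hconst : coeffShift k e = Finsupp.single 0 (e k) := by
    ext h
    rw [coeffShift_apply, Finsupp.single_apply]
    split_ifs with h0
    · rw [← h0, zero_add]
    · by_contra hh
      have : h + k ≤ k := hk.2 (Finsupp.mem_support_iff.2 hh) le_add_self
      exact h0 (add_eq_right.1 (this.antisymm le_add_self)).symm
  obtain ⟨n, hn⟩ := (hshift k).exists
  rw [hconst, binomialSum_single, binomialFun_zero, mul_one] at hn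
  exact (Finsupp.mem_support_iff.1 hk.1) hn

/-- `f` agrees for large `n` with an integral combination of the functions `binom(n + k, k)`. -/
def IsEventuallyBinomial (f : (Fin d → ℕ) → ℤ) : Prop :=
  ∃ e : (Fin d → ℕ) →₀ ℤ, ∀ᶠ n in atTop, f n = binomialSum n e

lemma eventually_const_of_eventually_single_add {f : (Fin d → ℕ) → ℤ}
    (hf : ∀ j, ∀ᶠ n in atTop, f (Pi.single j 1 + n) = f n) :
    ∃ c, ∀ᶠ n in atTop, f n = c := by
  obtain ⟨n₀, hn₀⟩ := eventually_atTop.1 (eventually_all.2 hf)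
  refine ⟨f n₀, eventually_atTop.2 ⟨n₀, fun n hn => ?_⟩⟩
  obtain ⟨u, rfl⟩ := exists_add_of_le hn
  rw [add_comm]
  induction u using induction_single_add with
  | zero => rw [zero_add]
  | step j u hu => rw [add_assoc, hn₀ _ le_add_self, hu le_self_add]

/-- A function all of whose partial differences are eventually binomial is eventually binomial:
the differences can be summed up one variable at a time. -/
lemma isEventuallyBinomial_of_difference {f : (Fin d → ℕ) → ℤ}
    (hf : ∀ j, ∃ q : (Fin d → ℕ) →₀ ℤ, ∀ᶠ n in atTop,
      f (Pi.single j 1 + n) - f n = binomialSum (Pi.single j 1 + n) q) :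
    IsEventuallyBinomial f := by
  have key : ∀ s : Finset (Fin d), ∃ g : (Fin d → ℕ) →₀ ℤ, ∀ j ∈ s, ∀ᶠ n in atTop,
      f (Pi.single j 1 + n) - binomialSum (Pi.single j 1 + n) g = f n - binomialSum n g := by
    intro s
    induction s using Finset.induction_on with
    | empty => exact ⟨0, by simp⟩
    | insert j s hj ih =>
      obtain ⟨g, hg⟩ := ih
      obtain ⟨q', hq'⟩ := hf j
      -- the difference in direction `j` of what is left
      set q := q' - coeffShift (Pi.single j 1) g with hq_def
      have hq : ∀ᶠ n in atTop, f (Pi.single j 1 + n) - binomialSum (Pi.single j 1 + n) g -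
          (f n - binomialSum n g) = binomialSum (Pi.single j 1 + n) q := by
        filter_upwards [hq'] with n hn
        rw [hq_def, map_sub, ← hn, ← binomialSum_single_add_sub]
        ring
      -- differences in two directions commute, so no index of `q` involves a direction in `s`
      have hqs : ∀ i ∈ s, coeffShift (Pi.single i 1) q = 0 := by
        intro i hi
        apply eq_zero_of_eventually_binomialSum_eq_zero
        rw [← eventually_add_left_iff (Pi.single i 1), ← eventually_add_left_iff (Pi.single j 1)]
        filter_upwards [hq, (eventually_add_left_iff (Pi.single i 1)).2 hq, hg i hi,
          (eventually_add_left_iff (Pi.single j 1)).2 (hg i hi)] with n h₁ h₂ h₃ h₄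
        rw [← binomialSum_single_add_sub, add_left_comm (Pi.single i 1), ← h₁, ← h₂,
          add_left_comm (Pi.single j 1), h₃, h₄, sub_self]
      -- raising the `j`-th index by one sums up `q` in direction `j`
      let G : (Fin d → ℕ) →₀ ℤ := Finsupp.mapDomain (fun h => h + Pi.single j 1) q
      have hG : ∀ h, G (h + Pi.single j 1) = q h := fun h =>
        Finsupp.mapDomain_apply (add_left_injective _) q h
      have hGj : coeffShift (Pi.single j 1) G = q := by
        ext h
        rw [coeffShift_apply, hG]
      have hGs : ∀ i ∈ s, coeffShift (Pi.single i 1) G = 0 := by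
        intro i hi
        have hij : i ≠ j := fun h => hj (h ▸ hi)
        ext h
        rw [coeffShift_apply]
        by_cases hh : h ∈ Set.range fun h : Fin d → ℕ => h + Pi.single j 1
        · obtain ⟨h, rfl⟩ := hh
          dsimp only
          rw [add_right_comm, hG, ← coeffShift_apply, hqs i hi]
          rfl
        · refine Finsupp.mapDomain_of_notMem_range _ _ ?_
          rintro ⟨h', hh'⟩
          refine hh ⟨h - Pi.single j 1, tsub_add_cancel_of_le fun l => ?_⟩
          have := congrFun hh' l
          rcases eq_or_ne l j with rfl | hl
          · simp only [Pi.add_apply, Pi.single_eq_same, Pi.single_eq_of_ne hij.symm] at this ⊢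
            omega
          · simp [hl]
      refine ⟨g + G, fun i hi => ?_⟩
      rcases Finset.mem_insert.1 hi with rfl | hi
      · filter_upwards [hq] with n hn
        have := binomialSum_single_add_sub i n G
        rw [hGj] at this
        rw [map_add, map_add]
        linarith
      · filter_upwards [hg i hi] with n hn
        have := binomialSum_single_add_sub i n G
        rw [hGs i hi, map_zero] at this
        rw [map_add, map_add]
        linarith
  obtain ⟨g, hg⟩ := key Finset.univ
  obtain ⟨c, hc⟩ := eventually_const_of_eventually_single_add
    (f := fun n => f n - binomialSum n g) fun j => hg j (Finset.mem_univ j)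
  refine ⟨g + Finsupp.single 0 c, ?_⟩
  filter_upwards [hc] with n hn
  rw [map_add, binomialSum_single, binomialFun_zero]
  linarith

/-- The polynomial `∏_i binom(X_i + k_i, k_i)`. -/
noncomputable def binomialPolynomial (k : Fin d → ℕ) : MvPolynomial (Fin d) ℚ :=
  ∏ i, ∏ m ∈ Finset.range (k i),
    (MvPolynomial.X i + MvPolynomial.C (m + 1 : ℚ)) * MvPolynomial.C ((m + 1 : ℚ)⁻¹)

lemma eval_binomialPolynomial (k n : Fin d → ℕ) :
    MvPolynomial.eval (fun i => (n i : ℚ)) (binomialPolynomial k) = (binomialFun k n : ℚ) := by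
  have key : ∀ a b : ℕ, ∏ m ∈ Finset.range b, ((a : ℚ) + (m + 1)) * (m + 1 : ℚ)⁻¹ =
      (a + b).choose b := by
    intro a b
    induction b with
    | zero => simp
    | succ b ih =>
      rw [Finset.prod_range_succ, ih]
      have h := Nat.add_one_mul_choose_eq (a + b) b
      have hb : (b + 1 : ℚ) ≠ 0 := by positivity
      rw [← add_assoc, ← div_eq_mul_inv, mul_div_assoc', div_eq_iff hb]
      have h' : ((a + b + 1 : ℕ) : ℚ) * ((a + b).choose b : ℕ) =
          ((a + b + 1).choose (b + 1) : ℕ) * ((b + 1 : ℕ) : ℚ) := by exact_mod_cast h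
      push_cast at h'
      rw [← add_assoc, ← h']
      ring
  simp only [binomialPolynomial, binomialFun, map_prod, map_mul, map_add, MvPolynomial.eval_X,
    MvPolynomial.eval_C, key]
  push_cast
  rfl

/-- The points with large natural coordinates are Zariski dense. -/
lemma eq_of_eventually_eval_eq {P Q : MvPolynomial (Fin d) ℚ}
    (h : ∀ᶠ n : Fin d → ℕ in atTop, MvPolynomial.eval (fun i => (n i : ℚ)) P =
      MvPolynomial.eval (fun i => (n i : ℚ)) Q) : P = Q := by
  obtain ⟨a, ha⟩ := eventually_atTop.1 h
  refine MvPolynomial.funext_set (fun i => (Nat.cast : ℕ → ℚ) '' Set.Ici (a i))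
    (fun i => (Set.Ici_infinite _).image Nat.cast_injective.injOn) fun x hx => ?_
  choose n hn hnx using fun i => hx i (Set.mem_univ i)
  obtain rfl : (fun i => (n i : ℚ)) = x := funext hnx
  exact ha n hn

lemma isBinomialExpansion_iff {P : MvPolynomial (Fin d) ℚ} {e : (Fin d → ℕ) →₀ ℤ} :
    IsBinomialExpansion P e ↔ ∀ n : Fin d → ℕ,
      MvPolynomial.eval (fun i => (n i : ℚ)) P = (binomialSum n e : ℚ) := by
  refine forall_congr' fun n => ?_
  simp [binomialSum, Finsupp.linearCombination_apply, Finsupp.sum, binomialFun]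

end Binomial

/-! ### Graded modules -/

section Graded

set_option linter.unusedSectionVars false

open DirectSum

variable {d : ℕ} {A S M : Type*} [CommRing A] [CommRing S] [Algebra A S]
  [AddCommGroup M] [Module S M] [Module A M] [IsScalarTower A S M]

lemma smul_mem_graded {𝒮 : (Fin d → ℕ) → Submodule A S} {ℳ : (Fin d → ℕ) → Submodule A M}
    [SetLike.GradedSMul 𝒮 ℳ] {u n : Fin d → ℕ} {a : S} {m : M} (ha : a ∈ 𝒮 u) (hm : m ∈ ℳ n) :
    a • m ∈ ℳ (u + n) :=
  SetLike.GradedSMul.smul_mem ha hm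

section Components

variable {𝒮 : (Fin d → ℕ) → Submodule A S} {ℳ : (Fin d → ℕ) → Submodule A M} [Decomposition ℳ]
  [SetLike.GradedSMul 𝒮 ℳ]

lemma decompose_smul_of_left {u : Fin d → ℕ} {a : S} (ha : a ∈ 𝒮 u) (m : M) (n : Fin d → ℕ) :
    (decompose ℳ (a • m) (u + n) : M) = a • (decompose ℳ m n : M) := by
  induction m using Decomposition.inductionOn ℳ with
  | zero => simp
  | @homogeneous i m =>
    rcases eq_or_ne i n with rfl | hin
    · rw [decompose_of_mem_same ℳ (smul_mem_graded ha m.2), decompose_of_mem_same ℳ m.2]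
    · rw [decompose_of_mem_ne ℳ (smul_mem_graded ha m.2) (fun h => hin (add_left_cancel h)),
        decompose_of_mem_ne ℳ m.2 hin, smul_zero]
  | add m m' h h' => simp [smul_add, h, h']

lemma decompose_smul_of_left_of_not_le {u n : Fin d → ℕ} {a : S} (ha : a ∈ 𝒮 u) (m : M)
    (hu : ¬ u ≤ n) : (decompose ℳ (a • m) n : M) = 0 := by
  induction m using Decomposition.inductionOn ℳ with
  | zero => simp
  | @homogeneous i m =>
    exact decompose_of_mem_ne ℳ (smul_mem_graded ha m.2) (fun h => hu (h ▸ le_self_add))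
  | add m m' h h' => simp [smul_add, h, h']

variable [GradedAlgebra 𝒮]

lemma decompose_smul_of_right {v : Fin d → ℕ} {m : M} (hm : m ∈ ℳ v) (s : S) (n : Fin d → ℕ) :
    (decompose ℳ (s • m) (n + v) : M) = (decompose 𝒮 s n : S) • m := by
  induction s using Decomposition.inductionOn 𝒮 with
  | zero => simp
  | @homogeneous i s =>
    rcases eq_or_ne i n with rfl | hin
    · rw [decompose_of_mem_same ℳ (smul_mem_graded s.2 hm), decompose_of_mem_same 𝒮 s.2]
    · rw [decompose_of_mem_ne ℳ (smul_mem_graded s.2 hm) (fun h => hin (add_right_cancel h)),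
        decompose_of_mem_ne 𝒮 s.2 hin, zero_smul]
  | add s s' h h' => simp [add_smul, h, h']

lemma isHomogeneous_annihilator (ℳ : (Fin d → ℕ) → Submodule A M) [Decomposition ℳ]
    [SetLike.GradedSMul 𝒮 ℳ] : (Module.annihilator S M).IsHomogeneous 𝒮 := by
  intro n r hr
  rw [Module.mem_annihilator] at hr ⊢
  intro m
  induction m using Decomposition.inductionOn ℳ with
  | zero => simp
  | @homogeneous i m => rw [← decompose_smul_of_right m.2, hr]; simp
  | add m m' h h' => rw [smul_add, h, h', add_zero]

end Components

/-- A family of submodules that spans and admits projections is a direct sum decomposition. -/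
lemma nonempty_decomposition_of_projection {ℳ : (Fin d → ℕ) → Submodule A M}
    (p : (Fin d → ℕ) → M →ₗ[A] M) (hp : ∀ n, ∀ m ∈ ℳ n, p n m = m)
    (hp' : ∀ n k, k ≠ n → ∀ m ∈ ℳ k, p n m = 0) (htop : ⨆ n, ℳ n = ⊤) :
    Nonempty (Decomposition ℳ) := by
  refine ⟨IsInternal.chooseDecomposition ℳ
    (isInternal_submodule_of_iSupIndep_of_iSup_eq_top (fun n => ?_) htop)⟩
  rw [Submodule.disjoint_def]
  intro m hm hm'
  have hle : ⨆ (k) (_ : k ≠ n), ℳ k ≤ LinearMap.ker (p n) :=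
    iSup₂_le fun k hk m hm => hp' n k hk m hm
  rw [← hp n m hm]
  exact hle hm'

variable (ℳ : (Fin d → ℕ) → Submodule A M)

/-- The projection of a graded module to its component of degree `n`. -/
def gradedProj [Decomposition ℳ] (n : Fin d → ℕ) : M →ₗ[A] M :=
  (ℳ n).subtype ∘ₗ component A _ _ n ∘ₗ (decomposeLinearEquiv ℳ).toLinearMap

/-- The grading of a submodule `K` of `M` by its intersections with the components of `M`. -/
def submoduleGrading (K : Submodule S M) : (Fin d → ℕ) → Submodule A K :=
  fun n => (ℳ n).comap (K.subtype.restrictScalars A)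

lemma nonempty_decomposition_submoduleGrading [Decomposition ℳ] {K : Submodule S M}
    (hK : K.IsHomogeneous ℳ) : Nonempty (Decomposition (submoduleGrading ℳ K)) := by
  classical
  refine nonempty_decomposition_of_projection
    (fun n => (gradedProj ℳ n).restrict (p := K.restrictScalars A) (q := K.restrictScalars A)
      fun m hm => hK n hm)
    (fun n m hm => Subtype.ext (decompose_of_mem_same ℳ hm))
    (fun n k hk m hm => Subtype.ext (decompose_of_mem_ne ℳ hm hk)) ?_
  rw [eq_top_iff]
  rintro m -
  have : m = ∑ n ∈ (decompose ℳ (m : M)).support, ⟨decompose ℳ (m : M) n, hK n m.2⟩ := by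
    apply Subtype.ext
    rw [AddSubmonoidClass.coe_finsetSum]
    exact (sum_support_decompose ℳ (m : M)).symm
  rw [this]
  exact sum_mem fun n _ => Submodule.mem_iSup_of_mem n (decompose ℳ (m : M) n).2

lemma mem_quotientGrading_mk {N : Submodule S M} {n : Fin d → ℕ} {m : M} (hm : m ∈ ℳ n) :
    N.mkQ m ∈ quotientGrading ℳ N n := ⟨m, hm, rfl⟩

lemma nonempty_decomposition_quotientGrading [Decomposition ℳ] {N : Submodule S M}
    (hN : N.IsHomogeneous ℳ) : Nonempty (Decomposition (quotientGrading ℳ N)) := by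
  classical
  let E := Submodule.Quotient.restrictScalarsEquiv A N
  let p : (Fin d → ℕ) → (M ⧸ N) →ₗ[A] (M ⧸ N) := fun n =>
    E.toLinearMap ∘ₗ (N.restrictScalars A).mapQ (N.restrictScalars A) (gradedProj ℳ n)
      (fun m hm => hN n hm) ∘ₗ E.symm.toLinearMap
  have hp : ∀ n m, p n (N.mkQ m) = N.mkQ (decompose ℳ m n) := fun n m => rfl
  refine nonempty_decomposition_of_projection p ?_ ?_ ?_
  · rintro n _ ⟨m, hm, rfl⟩
    exact (hp n m).trans (congrArg _ (decompose_of_mem_same ℳ hm))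
  · rintro n k hk _ ⟨m, hm, rfl⟩
    exact (hp n m).trans ((congrArg _ (decompose_of_mem_ne ℳ hm hk)).trans (map_zero _))
  · rw [eq_top_iff]
    rintro m -
    obtain ⟨m, rfl⟩ := N.mkQ_surjective m
    rw [← sum_support_decompose ℳ m, map_sum]
    exact sum_mem fun n _ =>
      Submodule.mem_iSup_of_mem n (mem_quotientGrading_mk ℳ (decompose ℳ m n).2)

variable (𝒮 : (Fin d → ℕ) → Submodule A S) [SetLike.GradedSMul 𝒮 ℳ]

lemma gradedSMul_submoduleGrading (K : Submodule S M) :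
    SetLike.GradedSMul 𝒮 (submoduleGrading ℳ K) :=
  ⟨fun {_ _ _ _} ha hm => smul_mem_graded (ℳ := ℳ) ha hm⟩

lemma gradedSMul_quotientGrading (N : Submodule S M) :
    SetLike.GradedSMul 𝒮 (quotientGrading ℳ N) := by
  refine ⟨fun {i j a m} ha hm => ?_⟩
  obtain ⟨m, hm, rfl⟩ := hm
  exact ⟨a • m, smul_mem_graded ha hm, map_smul N.mkQ a m⟩

variable {ℳ 𝒮}

/-- A finitely generated graded module is generated by finitely many homogeneous elements. -/
lemma exists_finset_homogeneous_span [Decomposition ℳ] [Module.Finite S M] :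
    ∃ G : Finset M, Submodule.span S (G : Set M) = ⊤ ∧ ∀ g ∈ G, ∃ n, g ∈ ℳ n := by
  classical
  obtain ⟨G, hG⟩ := (Module.Finite.fg_top : (⊤ : Submodule S M).FG)
  refine ⟨G.biUnion fun g => (decompose ℳ g).support.image fun n => (decompose ℳ g n : M), ?_, ?_⟩
  · rw [eq_top_iff, ← hG, Submodule.span_le]
    intro g hg
    rw [SetLike.mem_coe, ← sum_support_decompose ℳ g]
    refine sum_mem fun n hn => Submodule.subset_span ?_
    exact Finset.mem_coe.2 (Finset.mem_biUnion.2 ⟨g, hg, Finset.mem_image_of_mem _ hn⟩)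
  · intro g hg
    obtain ⟨g', _, hg⟩ := Finset.mem_biUnion.1 hg
    obtain ⟨n, _, rfl⟩ := Finset.mem_image.1 hg
    exact ⟨n, (decompose ℳ g' n).2⟩

/-- Multiplication by a homogeneous element of degree `u`, between graded components. -/
def gradedMul {u : Fin d → ℕ} {a : S} (ha : a ∈ 𝒮 u) (n : Fin d → ℕ) : ℳ n →ₗ[A] ℳ (u + n) :=
  (LinearMap.lsmul S M a |>.restrictScalars A).restrict fun _ hm => smul_mem_graded ha hm

lemma coe_gradedMul {u : Fin d → ℕ} {a : S} (ha : a ∈ 𝒮 u) (n : Fin d → ℕ) (m : ℳ n) :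
    (gradedMul (ℳ := ℳ) ha n m : M) = a • (m : M) := rfl

section Exact

variable {C : Type*} [AddCommGroup C] [Module S C] [Module A C] [IsScalarTower A S C]
  {f : M →ₗ[S] C} {u : Fin d → ℕ} {a : S}

/-- The restriction of a linear map to a component, onto the image of that component. -/
def gradedMap (ℳ : (Fin d → ℕ) → Submodule A M) (f : M →ₗ[S] C) (n : Fin d → ℕ) :
    ℳ n →ₗ[A] (ℳ n).map (f.restrictScalars A) :=
  (f.restrictScalars A).restrict fun _ hm => Submodule.mem_map_of_mem hm

lemma gradedMap_surjective (n : Fin d → ℕ) : Function.Surjective (gradedMap ℳ f n) := by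
  rintro ⟨_, m, hm, rfl⟩
  exact ⟨⟨m, hm⟩, rfl⟩

lemma exact_gradedMul_gradedMap [Decomposition ℳ] (ha : a ∈ 𝒮 u)
    (hf : ∀ m, f m = 0 ↔ ∃ m', m = a • m') (n : Fin d → ℕ) :
    Function.Exact (gradedMul (ℳ := ℳ) ha n) (gradedMap ℳ f (u + n)) := by
  intro y
  constructor
  · intro hy
    obtain ⟨m, hm⟩ := (hf y).1 (congrArg Subtype.val hy)
    refine ⟨decompose ℳ m n, Subtype.ext ?_⟩
    rw [coe_gradedMul, ← decompose_smul_of_left ha, ← hm, decompose_of_mem_same ℳ y.2]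
  · rintro ⟨m, rfl⟩
    exact Subtype.ext ((hf _).2 ⟨m, rfl⟩)

/-- The lengths along `0 → (0 : a)_n → M_n → M_{u + n} → C_{u + n} → 0`, where `C` is the cokernel
of multiplication by `a`. Lengths may be infinite. -/
lemma length_add_length_ker [Decomposition ℳ] (ha : a ∈ 𝒮 u)
    (hf : ∀ m, f m = 0 ↔ ∃ m', m = a • m') (n : Fin d → ℕ) :
    Module.length A (ℳ (u + n)) + Module.length A (LinearMap.ker (gradedMul (ℳ := ℳ) ha n)) =
      Module.length A (ℳ n) + Module.length A ((ℳ (u + n)).map (f.restrictScalars A)) := by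
  set μ := gradedMul (ℳ := ℳ) ha n with hμ
  rw [Module.length_eq_add_of_exact (LinearMap.range μ).subtype (gradedMap ℳ f (u + n))
      (Submodule.subtype_injective _) (gradedMap_surjective _) ?_,
    Module.length_eq_add_of_exact (LinearMap.ker μ).subtype μ.rangeRestrict
      (Submodule.subtype_injective _) μ.surjective_rangeRestrict ?_]
  · abel
  · rw [LinearMap.exact_iff, LinearMap.ker_rangeRestrict, Submodule.range_subtype]
  · rw [LinearMap.exact_iff, Submodule.range_subtype]
    exact (exact_gradedMul_gradedMap ha hf n).linearMap_ker_eq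

lemma length_eq_of_not_le [Decomposition ℳ] (ha : a ∈ 𝒮 u)
    (hf : ∀ m, f m = 0 ↔ ∃ m', m = a • m') {n : Fin d → ℕ} (hn : ¬ u ≤ n) :
    Module.length A (ℳ n) = Module.length A ((ℳ n).map (f.restrictScalars A)) := by
  refine (LinearEquiv.ofBijective (gradedMap ℳ f n)
    ⟨(injective_iff_map_eq_zero _).2 fun m hm => ?_, gradedMap_surjective n⟩).length_eq
  obtain ⟨m', hm'⟩ := (hf m).1 (congrArg Subtype.val hm)
  apply Subtype.ext
  rw [← decompose_of_mem_same ℳ m.2, hm', decompose_smul_of_left_of_not_le ha m' hn]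
  rfl

end Exact

end Graded

/-! ### Existence of the Hilbert polynomial -/

section HilbertFunction

open DirectSum

/-- The Hilbert function of a graded module, with the junk value `0` at infinite lengths. -/
noncomputable def hilbertFun {d : ℕ} {A M : Type*} [CommRing A] [AddCommGroup M] [Module A M]
    (ℳ : (Fin d → ℕ) → Submodule A M) (n : Fin d → ℕ) : ℤ :=
  ((Module.length A (ℳ n)).toNat : ℤ)

section Adjoin

variable {A S M : Type*} [CommRing A] [CommRing S] [Algebra A S]
  [AddCommGroup M] [Module S M]

/-- A generator that annihilates the module may be dropped. -/
lemma finite_adjoin_of_smul_eq_zero {s : Set S} {x : S} (hx : ∀ m : M, x • m = 0)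
    [Module.Finite (Algebra.adjoin A (insert x s)) M] :
    Module.Finite (Algebra.adjoin A s) M := by
  obtain ⟨G, hG⟩ := (Module.Finite.fg_top : (⊤ : Submodule (Algebra.adjoin A (insert x s)) M).FG)
  refine ⟨⟨G, ?_⟩⟩
  set L := Submodule.span (Algebra.adjoin A s) (G : Set M) with hL
  have hmul : ∀ b ∈ Algebra.adjoin A (insert x s), ∀ m ∈ L, b • m ∈ L := by
    intro b hb
    induction hb using Algebra.adjoin_induction with
    | mem y hy =>
      intro m hm
      rcases hy with rfl | hy
      · rw [hx]
        exact zero_mem _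
      · exact L.smul_mem (⟨y, Algebra.subset_adjoin hy⟩ : Algebra.adjoin A s) hm
    | algebraMap r =>
      intro m hm
      exact L.smul_mem (algebraMap A (Algebra.adjoin A s) r) hm
    | add y z _ _ h h' =>
      intro m hm
      rw [add_smul]
      exact add_mem (h m hm) (h' m hm)
    | mul y z _ _ h h' =>
      intro m hm
      rw [mul_smul]
      exact h _ (h' m hm)
  rw [eq_top_iff]
  rintro m -
  have hm : m ∈ Submodule.span (Algebra.adjoin A (insert x s)) (G : Set M) := hG ▸ trivial
  induction hm using Submodule.span_induction with
  | mem m hm => exact Submodule.subset_span hm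
  | zero => exact zero_mem _
  | add m m' _ _ h h' => exact add_mem h h'
  | smul b m _ h => exact hmul b b.2 m h

lemma finite_adjoin_of_adjoin_eq_top {s : Set S} (hs : Algebra.adjoin A s = ⊤)
    [Module.Finite S M] : Module.Finite (Algebra.adjoin A s) M := by
  obtain ⟨G, hG⟩ := (Module.Finite.fg_top : (⊤ : Submodule S M).FG)
  refine ⟨⟨G, ?_⟩⟩
  rw [eq_top_iff]
  rintro m -
  have hm : m ∈ Submodule.span S (G : Set M) := hG ▸ trivial
  induction hm using Submodule.span_induction with
  | mem m hm => exact Submodule.subset_span hm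
  | zero => exact zero_mem _
  | add m m' _ _ h h' => exact add_mem h h'
  | smul b m _ h =>
    exact Submodule.smul_mem _ (⟨b, hs ▸ trivial⟩ : Algebra.adjoin A s) h

lemma exists_finset_subset_mem_adjoin {U : Set S} {y : S} (hy : y ∈ Algebra.adjoin A U) :
    ∃ T : Finset S, (T : Set S) ⊆ U ∧ y ∈ Algebra.adjoin A (T : Set S) := by
  classical
  induction hy using Algebra.adjoin_induction with
  | mem y hy => exact ⟨{y}, by simpa using hy, Algebra.subset_adjoin (by simp)⟩
  | algebraMap r => exact ⟨∅, by simp, Subalgebra.algebraMap_mem _ r⟩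
  | add y z _ _ h h' =>
    obtain ⟨T, hT, hy⟩ := h
    obtain ⟨T', hT', hz⟩ := h'
    exact ⟨T ∪ T', by simp [hT, hT'], add_mem (Algebra.adjoin_mono (by simp) hy)
      (Algebra.adjoin_mono (by simp) hz)⟩
  | mul y z _ _ h h' =>
    obtain ⟨T, hT, hy⟩ := h
    obtain ⟨T', hT', hz⟩ := h'
    exact ⟨T ∪ T', by simp [hT, hT'], mul_mem (Algebra.adjoin_mono (by simp) hy)
      (Algebra.adjoin_mono (by simp) hz)⟩

lemma exists_finset_adjoin_eq_top [Algebra.FiniteType A S] {U : Set S}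
    (hU : Algebra.adjoin A U = ⊤) :
    ∃ T : Finset S, (T : Set S) ⊆ U ∧ Algebra.adjoin A (T : Set S) = ⊤ := by
  classical
  obtain ⟨F, hF⟩ := Algebra.FiniteType.out (R := A) (A := S)
  choose T hT hT' using fun y : S =>
    exists_finset_subset_mem_adjoin (A := A) (U := U) (y := y) (hU ▸ trivial)
  refine ⟨F.biUnion T, by simpa using fun y _ => hT y, ?_⟩
  rw [eq_top_iff, ← hF, Algebra.adjoin_le_iff]
  intro y hy
  refine Algebra.adjoin_mono ?_ (hT' y)
  exact_mod_cast Finset.subset_biUnion_of_mem T hy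

end Adjoin

section Subalgebra

variable {A S M C : Type*} [CommRing A] [CommRing S] [Algebra A S] [AddCommGroup M] [Module S M]
  [AddCommGroup C] [Module S C]

lemma finite_subalgebra_of_surjective (B : Subalgebra A S) [Module.Finite B M] (f : M →ₗ[S] C)
    (hf : Function.Surjective f) : Module.Finite B C :=
  Module.Finite.of_surjective (f.restrictScalars B) hf

lemma finite_subalgebra_of_injective (B : Subalgebra A S) [IsNoetherianRing B] [Module.Finite B M]
    (f : C →ₗ[S] M) (hf : Function.Injective f) : Module.Finite B C :=
  have := isNoetherian_of_isNoetherianRing_of_finite B M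
  Module.Finite.of_injective (f.restrictScalars B) hf

end Subalgebra

section Step

set_option linter.unusedSectionVars false

variable {d : ℕ} {A S M : Type*} [CommRing A] [CommRing S] [Algebra A S]
  [AddCommGroup M] [Module S M] [Module A M] [IsScalarTower A S M]
  {𝒮 : (Fin d → ℕ) → Submodule A S} {ℳ : (Fin d → ℕ) → Submodule A M}
  [Decomposition ℳ] [SetLike.GradedSMul 𝒮 ℳ]

/-- Without generators in the `j`-th direction, the components far out in that direction vanish. -/
lemma exists_forall_eq_bot {s : Set S} {j : Fin d}
    (hs : ∀ x ∈ s, ∃ i, i ≠ j ∧ x ∈ 𝒮 (Pi.single i 1)) [Module.Finite (Algebra.adjoin A s) M] :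
    ∃ N, ∀ n, N < n j → ℳ n = ⊥ := by
  classical
  obtain ⟨G, hG⟩ := (Module.Finite.fg_top : (⊤ : Submodule (Algebra.adjoin A s) M).FG)
  let N : ℕ := G.sup fun g => (decompose ℳ g).support.sup fun n => n j
  refine ⟨N, ?_⟩
  have hmul : ∀ b ∈ Algebra.adjoin A s, ∀ m : M,
      (∀ n, N < n j → (decompose ℳ m n : M) = 0) →
      ∀ n, N < n j → (decompose ℳ (b • m) n : M) = 0 := by
    intro b hb
    induction hb using Algebra.adjoin_induction with
    | mem y hy =>
      obtain ⟨i, hij, hy⟩ := hs y hy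
      intro m hm n hn
      by_cases hin : Pi.single i 1 ≤ n
      · obtain ⟨n, rfl⟩ := exists_add_of_le hin
        rw [decompose_smul_of_left hy, hm n (by simpa [hij.symm] using hn), smul_zero]
      · exact decompose_smul_of_left_of_not_le hy m hin
    | algebraMap r =>
      intro m hm n hn
      rw [algebraMap_smul, decompose_smul, DirectSum.smul_apply, Submodule.coe_smul, hm n hn,
        smul_zero]
    | add y z _ _ h h' =>
      intro m hm n hn
      rw [add_smul, decompose_add, DirectSum.add_apply, Submodule.coe_add, h m hm n hn,
        h' m hm n hn, add_zero]
    | mul y z _ _ h h' =>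
      intro m hm n hn
      rw [mul_smul]
      exact h _ (h' m hm) n hn
  have hall : ∀ m : M, ∀ n, N < n j → (decompose ℳ m n : M) = 0 := by
    intro m
    have hm : m ∈ Submodule.span (Algebra.adjoin A s) (G : Set M) := hG ▸ trivial
    induction hm using Submodule.span_induction with
    | mem m hm =>
      intro n hn
      by_contra h
      have h₁ : n ∈ (decompose ℳ m).support := by
        rw [DFinsupp.mem_support_iff]
        exact fun h0 => h (by rw [h0]; rfl)
      have h₂ := Finset.le_sup (f := fun n : Fin d → ℕ => n j) h₁
      have h₃ := Finset.le_sup (f := fun g => (decompose ℳ g).support.sup fun n => n j) hm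
      exact absurd hn (not_lt.2 (h₂.trans h₃))
    | zero => simp
    | add m m' _ _ h h' =>
      intro n hn
      rw [decompose_add, DirectSum.add_apply, Submodule.coe_add, h n hn, h' n hn, add_zero]
    | smul b m _ h => exact hmul b b.2 m h
  intro n hn
  rw [eq_bot_iff]
  intro m hm
  rw [Submodule.mem_bot, ← decompose_of_mem_same ℳ hm]
  exact hall m n hn

lemma isHomogeneous_ker_lsmul {u : Fin d → ℕ} {a : S} (ha : a ∈ 𝒮 u) :
    (LinearMap.ker (LinearMap.lsmul S M a)).IsHomogeneous ℳ := by
  intro n m hm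
  rw [LinearMap.mem_ker, LinearMap.lsmul_apply] at hm ⊢
  rw [← decompose_smul_of_left ha, hm]
  simp

lemma isHomogeneous_sup_range_lsmul {u : Fin d → ℕ} {a : S} (ha : a ∈ 𝒮 u) {N : Submodule S M}
    (hN : N.IsHomogeneous ℳ) :
    (N ⊔ LinearMap.range (LinearMap.lsmul S M a)).IsHomogeneous ℳ := by
  intro n y hy
  obtain ⟨z, hz, _, ⟨m, rfl⟩, rfl⟩ := Submodule.mem_sup.1 hy
  rw [decompose_add, DirectSum.add_apply, Submodule.coe_add, LinearMap.lsmul_apply]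
  refine add_mem (Submodule.mem_sup_left (hN n hz)) (Submodule.mem_sup_right ?_)
  by_cases hn : u ≤ n
  · obtain ⟨n, rfl⟩ := exists_add_of_le hn
    exact ⟨_, (decompose_smul_of_left ha m n).symm⟩
  · rw [decompose_smul_of_left_of_not_le ha m hn]
    exact zero_mem _

lemma isHomogeneous_range_lsmul {u : Fin d → ℕ} {a : S} (ha : a ∈ 𝒮 u) :
    (LinearMap.range (LinearMap.lsmul S M a)).IsHomogeneous ℳ := by
  have hbot : (⊥ : Submodule S M).IsHomogeneous ℳ := by
    intro n m hm
    obtain rfl := (Submodule.mem_bot S).1 hm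
    simp
  simpa using isHomogeneous_sup_range_lsmul ha hbot

lemma length_submoduleGrading_ker {u : Fin d → ℕ} {a : S} (ha : a ∈ 𝒮 u) (n : Fin d → ℕ) :
    Module.length A (submoduleGrading ℳ (LinearMap.ker (LinearMap.lsmul S M a)) n) =
      Module.length A (LinearMap.ker (gradedMul (ℳ := ℳ) ha n)) :=
  LinearEquiv.length_eq
    { toFun := fun m => ⟨⟨m.1.1, m.2⟩, Subtype.ext m.1.2⟩
      invFun := fun m => ⟨⟨m.1.1, congrArg Subtype.val m.2⟩, m.1.2⟩
      map_add' := fun _ _ => rfl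
      map_smul' := fun _ _ => rfl }

lemma mkQ_range_lsmul_eq_zero_iff (a : S) (m : M) :
    (LinearMap.range (LinearMap.lsmul S M a)).mkQ m = 0 ↔ ∃ m', m = a • m' := by
  rw [Submodule.mkQ_apply, Submodule.Quotient.mk_eq_zero, LinearMap.mem_range]
  simp only [LinearMap.lsmul_apply, eq_comm]

/-- Finite length of the components descends from `M/aM` to `M`, by induction on the `j`-th
coordinate of the degree. -/
lemma length_ne_top_of_quotient {j : Fin d} {a : S} (ha : a ∈ 𝒮 (Pi.single j 1))
    (hC : ∀ n, Module.length A
      (quotientGrading ℳ (LinearMap.range (LinearMap.lsmul S M a)) n) ≠ ⊤) (n : Fin d → ℕ) :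
    Module.length A (ℳ n) ≠ ⊤ := by
  induction h : n j generalizing n with
  | zero =>
    rw [length_eq_of_not_le ha (mkQ_range_lsmul_eq_zero_iff a)]
    · exact hC n
    · intro hle
      have := hle j
      simp [h] at this
  | succ k ih =>
    obtain ⟨n, rfl⟩ : ∃ n' : Fin d → ℕ, n = Pi.single j 1 + n' :=
      ⟨_, (add_tsub_cancel_of_le (single_one_le (h ▸ k.succ_pos))).symm⟩
    have hn := ih n (by simpa [add_comm] using h)
    have := length_add_length_ker (ℳ := ℳ) ha (mkQ_range_lsmul_eq_zero_iff a) n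
    exact ne_top_of_le_ne_top (WithTop.add_ne_top.2 ⟨hn, hC _⟩) (le_self_add.trans this.le)

/-- The difference of the Hilbert function in a direction in which both the kernel and the cokernel
of a multiplication are controlled. -/
lemma exists_hilbertFun_single_add_sub {j : Fin d} {a : S} (ha : a ∈ 𝒮 (Pi.single j 1))
    (hfin : ∀ n, Module.length A (ℳ n) ≠ ⊤)
    (hK : IsEventuallyBinomial
      (hilbertFun (submoduleGrading ℳ (LinearMap.ker (LinearMap.lsmul S M a)))))
    (hC : IsEventuallyBinomial
      (hilbertFun (quotientGrading ℳ (LinearMap.range (LinearMap.lsmul S M a))))) :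
    ∃ q : (Fin d → ℕ) →₀ ℤ, ∀ᶠ n in atTop,
      hilbertFun ℳ (Pi.single j 1 + n) - hilbertFun ℳ n = binomialSum (Pi.single j 1 + n) q := by
  obtain ⟨e₁, he₁⟩ := hK
  obtain ⟨e₂, he₂⟩ := hC
  -- the kernel contributes in degree `n`, which is re-expanded around `e_j + n`
  refine ⟨e₂ - e₁ + coeffShift (Pi.single j 1) e₁, ?_⟩
  filter_upwards [he₁, (eventually_add_left_iff (Pi.single j 1)).2 he₂] with n h₁ h₂
  rw [map_add, map_sub, ← binomialSum_single_add_sub, ← h₁, ← h₂]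
  have h := length_add_length_ker (ℳ := ℳ) ha (mkQ_range_lsmul_eq_zero_iff a) n
  rw [← length_submoduleGrading_ker ha] at h
  change _ = _ + Module.length A (quotientGrading ℳ _ (Pi.single j 1 + n)) at h
  have hKfin : Module.length A
      (submoduleGrading ℳ (LinearMap.ker (LinearMap.lsmul S M a)) n) ≠ ⊤ := by
    rw [length_submoduleGrading_ker ha]
    exact ne_top_of_le_ne_top (hfin n)
      (Module.length_le_of_injective (LinearMap.ker _).subtype (Submodule.subtype_injective _))
  have hCfin : Module.length A (quotientGrading ℳ (LinearMap.range (LinearMap.lsmul S M a))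
      (Pi.single j 1 + n)) ≠ ⊤ :=
    ne_top_of_le_ne_top (hfin (Pi.single j 1 + n))
      (Module.length_le_of_surjective _ (gradedMap_surjective (ℳ := ℳ)
        (f := (LinearMap.range (LinearMap.lsmul S M a)).mkQ) (Pi.single j 1 + n)))
  have h' := congrArg ENat.toNat h
  rw [ENat.toNat_add (hfin _) hKfin, ENat.toNat_add (hfin _) hCfin] at h'
  simp only [hilbertFun]
  have h'' := congrArg (Nat.cast : ℕ → ℤ) h'
  push_cast at h''
  linarith

end Step

/-- Hilbert's theorem by induction on the set of generators of degree one: a generator in each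
direction controls the difference of the Hilbert function in that direction. -/
theorem length_ne_top_and_isEventuallyBinomial {d : ℕ} {A : Type*} [CommRing A]
    [IsArtinianRing A] {S : Type*} [CommRing S] [Algebra A S]
    (𝒮 : (Fin d → ℕ) → Submodule A S) (T : Finset S)
    (hT : ∀ x ∈ T, ∃ j, x ∈ 𝒮 (Pi.single j 1))
    {M : Type*} [AddCommGroup M] [Module S M] [Module A M] [IsScalarTower A S M]
    (ℳ : (Fin d → ℕ) → Submodule A M) [Decomposition ℳ] [SetLike.GradedSMul 𝒮 ℳ]
    [Module.Finite (Algebra.adjoin A (T : Set S)) M] :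
    (∀ n, Module.length A (ℳ n) ≠ ⊤) ∧ IsEventuallyBinomial (hilbertFun ℳ) := by
  classical
  induction T using Finset.strongInduction generalizing M with
  | H T ih =>
  -- the induction hypothesis for the kernel and the cokernel of a generator
  have key : ∀ x ∈ T, ∀ j, x ∈ 𝒮 (Pi.single j 1) →
      ((∀ n, Module.length A
        (quotientGrading ℳ (LinearMap.range (LinearMap.lsmul S M x)) n) ≠ ⊤) ∧
      IsEventuallyBinomial
        (hilbertFun (quotientGrading ℳ (LinearMap.range (LinearMap.lsmul S M x))))) ∧
      IsEventuallyBinomial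
        (hilbertFun (submoduleGrading ℳ (LinearMap.ker (LinearMap.lsmul S M x)))) := by
    intro x hxT j hx
    have hins : insert x ((T.erase x : Finset S) : Set S) = (T : Set S) := by
      rw [← Finset.coe_insert, Finset.insert_erase hxT]
    have hlt := Finset.erase_ssubset hxT
    have hsub : ∀ y ∈ T.erase x, ∃ j, y ∈ 𝒮 (Pi.single j 1) :=
      fun y hy => hT y (Finset.mem_of_mem_erase hy)
    have : IsNoetherianRing (Algebra.adjoin A (T : Set S)) :=
      have : Algebra.FiniteType A (Algebra.adjoin A (T : Set S)) :=
        (Subalgebra.fg_iff_finiteType _).1 (Subalgebra.fg_adjoin_finset T)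
      Algebra.FiniteType.isNoetherianRing A _
    constructor
    · obtain ⟨_⟩ := nonempty_decomposition_quotientGrading ℳ
        (isHomogeneous_range_lsmul (ℳ := ℳ) hx)
      have := gradedSMul_quotientGrading ℳ 𝒮 (LinearMap.range (LinearMap.lsmul S M x))
      have : Module.Finite (Algebra.adjoin A (insert x ((T.erase x : Finset S) : Set S)))
          (M ⧸ LinearMap.range (LinearMap.lsmul S M x)) := by
        rw [hins]
        exact finite_subalgebra_of_surjective (M := M) _ _ (Submodule.mkQ_surjective _)
      have := finite_adjoin_of_smul_eq_zero (A := A)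
        (s := ((T.erase x : Finset S) : Set S)) (x := x) (M := M ⧸ LinearMap.range (LinearMap.lsmul S M x)) (by
          intro m
          obtain ⟨m, rfl⟩ := Submodule.mkQ_surjective _ m
          rw [← map_smul, mkQ_range_lsmul_eq_zero_iff]
          exact ⟨m, rfl⟩)
      exact ih _ hlt hsub _
    · obtain ⟨_⟩ := nonempty_decomposition_submoduleGrading ℳ
        (isHomogeneous_ker_lsmul (ℳ := ℳ) hx)
      have := gradedSMul_submoduleGrading ℳ 𝒮 (LinearMap.ker (LinearMap.lsmul S M x))
      have : Module.Finite (Algebra.adjoin A (insert x ((T.erase x : Finset S) : Set S)))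
          (LinearMap.ker (LinearMap.lsmul S M x)) := by
        rw [hins]
        exact finite_subalgebra_of_injective (M := M) _ _ (Submodule.subtype_injective _)
      have := finite_adjoin_of_smul_eq_zero (A := A)
        (s := ((T.erase x : Finset S) : Set S)) (x := x) (M := LinearMap.ker (LinearMap.lsmul S M x)) (fun m => Subtype.ext m.2)
      exact (ih _ hlt hsub _).2
  have hfin : ∀ n, Module.length A (ℳ n) ≠ ⊤ := by
    rcases T.eq_empty_or_nonempty with rfl | ⟨x, hxT⟩
    · have hA : Module.Finite A M := by
        have : Module.Finite A (Algebra.adjoin A ((∅ : Finset S) : Set S)) := by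
          rw [Finset.coe_empty, Algebra.adjoin_empty]
          exact Module.Finite.of_surjective (Algebra.linearMap A (⊥ : Subalgebra A S))
            fun ⟨y, hy⟩ => by
              obtain ⟨r, rfl⟩ := Algebra.mem_bot.1 hy
              exact ⟨r, rfl⟩
        exact Module.Finite.trans (Algebra.adjoin A ((∅ : Finset S) : Set S)) M
      intro n
      exact Module.length_ne_top
    · obtain ⟨j, hx⟩ := hT x hxT
      exact length_ne_top_of_quotient hx (key x hxT j hx).1.1
  refine ⟨hfin, ?_⟩
  by_cases hdir : ∀ j, ∃ x ∈ T, x ∈ 𝒮 (Pi.single j 1)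
  · refine isEventuallyBinomial_of_difference fun j => ?_
    obtain ⟨x, hxT, hx⟩ := hdir j
    exact exists_hilbertFun_single_add_sub hx hfin (key x hxT j hx).2 (key x hxT j hx).1.2
  · push Not at hdir
    obtain ⟨j, hj⟩ := hdir
    obtain ⟨N, hN⟩ := exists_forall_eq_bot (ℳ := ℳ) (𝒮 := 𝒮) (s := (T : Set S)) (j := j)
      fun x hx => by
        obtain ⟨i, hi⟩ := hT x hx
        exact ⟨i, fun hij => hj x hx (hij ▸ hi), hi⟩
    refine ⟨0, eventually_atTop.2 ⟨Pi.single j (N + 1), fun n hn => ?_⟩⟩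
    have hnj : N < n j := by simpa using hn j
    rw [map_zero, hilbertFun, hN n hnj, Module.length_bot]
    rfl

section HilbertPolynomial

set_option linter.unusedSectionVars false

variable {d : ℕ} {A S M : Type*} [CommRing A] [IsArtinianRing A] [CommRing S] [Algebra A S]
  {𝒮 : (Fin d → ℕ) → Submodule A S} [AddCommGroup M] [Module S M] [Module A M]
  [IsScalarTower A S M] [Module.Finite S M]

lemma IsStandard.exists_finset (hS : IsStandard 𝒮) :
    ∃ T : Finset S, (∀ x ∈ T, ∃ j, x ∈ 𝒮 (Pi.single j 1)) ∧
      Algebra.adjoin A (T : Set S) = ⊤ := by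
  have := hS.1
  obtain ⟨T, hTU, hT⟩ := exists_finset_adjoin_eq_top hS.2
  exact ⟨T, fun x hx => by simpa using hTU hx, hT⟩

variable (ℳ : (Fin d → ℕ) → Submodule A M) [Decomposition ℳ] [SetLike.GradedSMul 𝒮 ℳ]

lemma IsStandard.length_ne_top (hS : IsStandard 𝒮) (n : Fin d → ℕ) :
    Module.length A (ℳ n) ≠ ⊤ := by
  obtain ⟨T, hT, hT'⟩ := hS.exists_finset
  have := finite_adjoin_of_adjoin_eq_top (M := M) hT'
  exact (length_ne_top_and_isEventuallyBinomial 𝒮 T hT ℳ).1 n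

lemma IsStandard.isEventuallyBinomial (hS : IsStandard 𝒮) :
    IsEventuallyBinomial (hilbertFun ℳ) := by
  obtain ⟨T, hT, hT'⟩ := hS.exists_finset
  have := finite_adjoin_of_adjoin_eq_top (M := M) hT'
  exact (length_ne_top_and_isEventuallyBinomial 𝒮 T hT ℳ).2

lemma IsStandard.isHilbertPolynomial_and_isBinomialExpansion (hS : IsStandard 𝒮) :
    IsHilbertPolynomial ℳ (hilbertPolynomial ℳ) ∧
      IsBinomialExpansion (hilbertPolynomial ℳ) (mixedCoeff ℳ) := by
  obtain ⟨e, he⟩ := hS.isEventuallyBinomial ℳ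
  let P : MvPolynomial (Fin d) ℚ := e.sum fun k c => MvPolynomial.C (c : ℚ) * binomialPolynomial k
  have hPe : IsBinomialExpansion P e := by
    rw [isBinomialExpansion_iff]
    intro n
    simp [P, Finsupp.sum, binomialSum, Finsupp.linearCombination_apply,
      eval_binomialPolynomial]
  have hP : IsHilbertPolynomial ℳ P := by
    filter_upwards [he] with n hn
    refine ⟨_, (ENat.natCast_toNat (hS.length_ne_top ℳ n)).symm, ?_⟩
    rw [isBinomialExpansion_iff.1 hPe, ← hn]
    simp [hilbertFun]
  have hH : IsHilbertPolynomial ℳ (hilbertPolynomial ℳ) := by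
    have h : ∃ P, IsHilbertPolynomial ℳ P := ⟨P, hP⟩
    rw [hilbertPolynomial, dif_pos h]
    exact h.choose_spec
  have hHP : hilbertPolynomial ℳ = P := by
    apply eq_of_eventually_eval_eq
    filter_upwards [hP, hH] with n ⟨l, hl, hl'⟩ ⟨l', hll, hll'⟩
    rw [hl', hll']
    exact_mod_cast hll.symm.trans hl
  refine ⟨hH, ?_⟩
  have h : ∃ e, IsBinomialExpansion (hilbertPolynomial ℳ) e := ⟨e, hHP ▸ hPe⟩
  rw [mixedCoeff, dif_pos h]
  exact h.choose_spec

/-- The coefficients `e(M; k)` compute the Hilbert function of `M` for large degrees. -/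
lemma IsStandard.eventually_hilbertFun_eq (hS : IsStandard 𝒮) :
    ∀ᶠ n in atTop, hilbertFun ℳ n = binomialSum n (mixedCoeff ℳ) := by
  obtain ⟨hP, he⟩ := hS.isHilbertPolynomial_and_isBinomialExpansion ℳ
  filter_upwards [hP] with n ⟨l, hl, hl'⟩
  rw [isBinomialExpansion_iff.1 he] at hl'
  rw [hilbertFun, hl, ENat.toNat_natCast]
  exact_mod_cast hl'.symm

end HilbertPolynomial

end HilbertFunction

/-! ### Reduction modulo filter-regular elements -/

section FilterRegularReduction

open DirectSum

variable {d : ℕ} {A S M : Type*} [CommRing A] [CommRing S] [Algebra A S]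
  [AddCommGroup M] [Module S M] [Module A M] [IsScalarTower A S M]

lemma spanSMul_empty : spanSMul M (∅ : Set S) = ⊥ := by
  simp [spanSMul]

lemma spanSMul_insert (a : S) (s : Set S) :
    spanSMul M (insert a s) = spanSMul M s ⊔ LinearMap.range (LinearMap.lsmul S M a) := by
  rw [spanSMul, spanSMul, Ideal.span_insert, Submodule.sup_smul, sup_comm,
    Submodule.ideal_span_singleton_smul]
  congr 1
  ext m
  simp [Submodule.mem_smul_pointwise_iff_exists]

lemma map_factor_quotientGrading (ℳ : (Fin d → ℕ) → Submodule A M) {N N' : Submodule S M}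
    (h : N ≤ N') (n : Fin d → ℕ) :
    (quotientGrading ℳ N n).map ((Submodule.factor h).restrictScalars A) =
      quotientGrading ℳ N' n := by
  rw [quotientGrading, ← Submodule.map_comp]
  rfl

lemma factor_sup_range_lsmul_eq_zero_iff {N : Submodule S M} (a : S) (m : M ⧸ N) :
    Submodule.factor (le_sup_left : N ≤ N ⊔ LinearMap.range (LinearMap.lsmul S M a)) m = 0 ↔
      ∃ m', m = a • m' := by
  obtain ⟨m, rfl⟩ := N.mkQ_surjective m
  have h : Submodule.factor (le_sup_left : N ≤ N ⊔ LinearMap.range (LinearMap.lsmul S M a))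
      (N.mkQ m) = (N ⊔ LinearMap.range (LinearMap.lsmul S M a)).mkQ m := rfl
  rw [h, Submodule.mkQ_apply, Submodule.Quotient.mk_eq_zero, Submodule.mem_sup]
  constructor
  · rintro ⟨z, hz, _, ⟨m', rfl⟩, rfl⟩
    refine ⟨N.mkQ m', ?_⟩
    rw [map_add, ← map_smul, N.mkQ_apply z, (Submodule.Quotient.mk_eq_zero N).2 hz, zero_add]
    rfl
  · rintro ⟨m', hm'⟩
    obtain ⟨m', rfl⟩ := N.mkQ_surjective m'
    rw [← map_smul, ← sub_eq_zero, ← map_sub, Submodule.mkQ_apply,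
      Submodule.Quotient.mk_eq_zero] at hm'
    exact ⟨_, hm', _, ⟨m', rfl⟩, sub_add_cancel _ _⟩

variable {𝒮 : (Fin d → ℕ) → Submodule A S} {ℳ : (Fin d → ℕ) → Submodule A M}
  [Decomposition ℳ] [SetLike.GradedSMul 𝒮 ℳ]

/-- Dividing out a filter-regular element of degree `e_j` lowers the `j`-th index of the
coefficients by one. -/
lemma eventually_hilbertFun_sup_range_lsmul {j : Fin d} {a : S} (ha : a ∈ 𝒮 (Pi.single j 1))
    (hfin : ∀ n, Module.length A (ℳ n) ≠ ⊤) {N : Submodule S M} (hN : N.IsHomogeneous ℳ)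
    (hreg : ∀ᶠ n in atTop, ∀ m ∈ quotientGrading ℳ N n, a • m = 0 → m = 0)
    {e : (Fin d → ℕ) →₀ ℤ}
    (he : ∀ᶠ n in atTop, hilbertFun (quotientGrading ℳ N) n = binomialSum n e) :
    ∀ᶠ n in atTop,
      hilbertFun (quotientGrading ℳ (N ⊔ LinearMap.range (LinearMap.lsmul S M a))) n =
        binomialSum n (coeffShift (Pi.single j 1) e) := by
  rw [← eventually_add_left_iff (Pi.single j 1)]
  filter_upwards [hreg, he, (eventually_add_left_iff (Pi.single j 1)).2 he] with n hn h₁ h₂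
  obtain ⟨_⟩ := nonempty_decomposition_quotientGrading ℳ hN
  have := gradedSMul_quotientGrading ℳ 𝒮 N
  have h := length_add_length_ker (ℳ := quotientGrading ℳ N) ha
    (factor_sup_range_lsmul_eq_zero_iff a) n
  have hker : LinearMap.ker (gradedMul (ℳ := quotientGrading ℳ N) ha n) = ⊥ := by
    rw [eq_bot_iff]
    intro m hm
    exact Subtype.ext (hn m m.2 (congrArg Subtype.val hm))
  have hquot : ∀ (N' : Submodule S M) n, Module.length A (quotientGrading ℳ N' n) ≠ ⊤ :=
    fun N' n => ne_top_of_le_ne_top (hfin n)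
      (Module.length_le_of_surjective _ (gradedMap_surjective (ℳ := ℳ) (f := N'.mkQ) n))
  rw [hker, Module.length_bot, add_zero, map_factor_quotientGrading] at h
  have h' := congrArg ENat.toNat h
  rw [ENat.toNat_add (hquot _ _) (hquot _ _)] at h'
  rw [← binomialSum_single_add_sub, ← h₁, ← h₂]
  simp only [hilbertFun, h']
  push_cast
  ring

/-- Dividing out a filter-regular sequence of the type `k` translates the coefficients by `k`. -/
lemma eventually_hilbertFun_filterRegularSequence {k : Fin d → ℕ} {t : ℕ} {x : Fin t → S}
    (hx : IsOfType 𝒮 k x) (hreg : IsFilterRegularSequence 𝒮 ℳ x)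
    (hfin : ∀ n, Module.length A (ℳ n) ≠ ⊤) {e : (Fin d → ℕ) →₀ ℤ}
    (he : ∀ᶠ n in atTop, hilbertFun ℳ n = binomialSum n e) :
    (spanSMul M (Set.range x)).IsHomogeneous ℳ ∧
      ∀ᶠ n in atTop, hilbertFun (quotientGrading ℳ (spanSMul M (Set.range x))) n =
        binomialSum n (coeffShift k e) := by
  classical
  obtain ⟨c, hc, hk⟩ := hx
  have key : ∀ i : ℕ, i ≤ t →
      (spanSMul M (x '' {l | (l : ℕ) < i})).IsHomogeneous ℳ ∧
      ∀ᶠ n in atTop, hilbertFun (quotientGrading ℳ (spanSMul M (x '' {l | (l : ℕ) < i}))) n =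
        binomialSum n (coeffShift
          (∑ l ∈ Finset.univ.filter (fun l : Fin t => (l : ℕ) < i), Pi.single (c l) 1) e) := by
    intro i
    induction i with
    | zero =>
      intro _
      have hempty : x '' {l | (l : ℕ) < 0} = ∅ := by simp
      rw [hempty, spanSMul_empty]
      constructor
      · intro n m hm
        obtain rfl := (Submodule.mem_bot S).1 hm
        simp
      · filter_upwards [he] with n hn
        have h0 : coeffShift 0 e = e := by
          ext h
          rw [coeffShift_apply, add_zero]
        have hbij : Function.Bijective (gradedMap ℳ (⊥ : Submodule S M).mkQ n) := by
          refine ⟨(injective_iff_map_eq_zero _).2 fun m hm => ?_, gradedMap_surjective n⟩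
          have hm' := congrArg Subtype.val hm
          exact Subtype.ext ((Submodule.mem_bot S).1 ((Submodule.Quotient.mk_eq_zero _).1 hm'))
        have hlen : Module.length A (ℳ n) =
            Module.length A (quotientGrading ℳ (⊥ : Submodule S M) n) :=
          (LinearEquiv.ofBijective _ hbij).length_eq
        simp only [Nat.not_lt_zero, Finset.filter_false, Finset.sum_empty, h0]
        rw [← hn, hilbertFun, hilbertFun, hlen]
    | succ i ih =>
      intro hi
      obtain ⟨hhom, hev⟩ := ih (Nat.le_of_succ_le hi)
      let l₀ : Fin t := ⟨i, hi⟩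
      have hset : {l : Fin t | (l : ℕ) < i + 1} = insert l₀ {l : Fin t | (l : ℕ) < i} := by
        ext l
        simp only [Set.mem_ofPred_eq, Set.mem_insert_iff, Fin.ext_iff, l₀]
        omega
      have hfilter : Finset.univ.filter (fun l : Fin t => (l : ℕ) < i + 1) =
          insert l₀ (Finset.univ.filter fun l : Fin t => (l : ℕ) < i) := by
        ext l
        simp only [Finset.mem_filter, Finset.mem_univ, true_and, Finset.mem_insert, Fin.ext_iff,
          l₀]
        omega
      rw [hset, Set.image_insert_eq, spanSMul_insert, hfilter,
        Finset.sum_insert (by simp [l₀]), coeffShift_add]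
      exact ⟨isHomogeneous_sup_range_lsmul (hc l₀) hhom,
        eventually_hilbertFun_sup_range_lsmul (hc l₀) hfin hhom (hreg l₀).2 hev⟩
  have hset : x '' {l | (l : ℕ) < t} = Set.range x := by
    rw [← Set.image_univ]
    congr
    ext l
    simp
  have hsum : ∑ l ∈ Finset.univ.filter (fun l : Fin t => (l : ℕ) < t), Pi.single (c l) 1 = k := by
    ext j
    simp only [Fin.is_lt, Finset.filter_true, Finset.sum_apply, Pi.single_apply, ← hk j,
      Finset.card_filter, eq_comm]
  have h := key t le_rfl
  rwa [hset, hsum] at h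

end FilterRegularReduction

/-! ### The support in the multiprojective spectrum -/

section Support

set_option linter.unusedSectionVars false

open DirectSum

variable {d : ℕ} {A S : Type*} [CommRing A] [CommRing S] [Algebra A S]

/-- The ideal generated by the elements of degree `e_j`. -/
def degreeIdeal (𝒮 : (Fin d → ℕ) → Submodule A S) (j : Fin d) : Ideal S :=
  Ideal.span (𝒮 (Pi.single j 1))

variable {𝒮 : (Fin d → ℕ) → Submodule A S} [GradedAlgebra 𝒮]

/-- In a standard graded algebra, elements of degree `n` are combinations of products of `n_j`
elements of each degree `e_j`. -/
lemma IsStandard.mem_prod_degreeIdeal_pow (hS : IsStandard 𝒮) {n : Fin d → ℕ} {s : S}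
    (hs : s ∈ 𝒮 n) : s ∈ ∏ j, degreeIdeal 𝒮 j ^ n j := by
  have hmon : ∀ w ∈ Submonoid.closure (⋃ j : Fin d, (𝒮 (Pi.single j 1) : Set S)),
      ∃ m, w ∈ 𝒮 m ∧ w ∈ ∏ j, degreeIdeal 𝒮 j ^ m j := by
    intro w hw
    induction hw using Submonoid.closure_induction with
    | mem y hy =>
      obtain ⟨j, hy⟩ := Set.mem_iUnion.1 hy
      refine ⟨Pi.single j 1, hy, ?_⟩
      rw [Finset.prod_eq_single j (fun i _ hij => by simp [hij]) (by simp), Pi.single_eq_same,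
        pow_one]
      exact Ideal.subset_span hy
    | one => exact ⟨0, SetLike.GradedOne.one_mem, by simp [-Ideal.one_eq_top]⟩
    | mul y z _ _ h h' =>
      obtain ⟨m, hy, hy'⟩ := h
      obtain ⟨m', hz, hz'⟩ := h'
      refine ⟨m + m', SetLike.GradedMul.mul_mem hy hz, ?_⟩
      simp only [Pi.add_apply, pow_add, Finset.prod_mul_distrib]
      exact Ideal.mul_mem_mul hy' hz'
  have hspan : s ∈ Submodule.span A
      (Submonoid.closure (⋃ j : Fin d, (𝒮 (Pi.single j 1) : Set S)) : Set S) := by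
    rw [← Algebra.adjoin_eq_span, hS.2]
    trivial
  have hcomp : ∀ n, (decompose 𝒮 s n : S) ∈ ∏ j, degreeIdeal 𝒮 j ^ n j := by
    clear hs
    induction hspan using Submodule.span_induction with
    | mem w hw =>
      intro n
      obtain ⟨m, hw, hw'⟩ := hmon w hw
      rcases eq_or_ne m n with rfl | hmn
      · rwa [decompose_of_mem_same 𝒮 hw]
      · rw [decompose_of_mem_ne 𝒮 hw hmn]
        exact zero_mem _
    | zero => simp
    | add y z _ _ h h' =>
      intro n
      rw [decompose_add, DirectSum.add_apply, Submodule.coe_add]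
      exact add_mem (h n) (h' n)
    | smul r y _ h =>
      intro n
      rw [decompose_smul, DirectSum.smul_apply, Submodule.coe_smul]
      exact Submodule.smul_of_tower_mem _ r (h n)
  rw [← decompose_of_mem_same 𝒮 hs]
  exact hcomp n

/-- A prime that misses an element of each degree `e_j` misses an element of each degree. -/
lemma exists_mem_notMem_of_forall_single {P : Ideal S} [P.IsPrime]
    (hP : ∀ j, ∃ x ∈ 𝒮 (Pi.single j 1), x ∉ P) (n : Fin d → ℕ) : ∃ s ∈ 𝒮 n, s ∉ P := by
  induction n using induction_single_add with
  | zero => exact ⟨1, SetLike.GradedOne.one_mem, (Ideal.ne_top_iff_one P).1 (Ideal.IsPrime.ne_top')⟩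
  | step j n ih =>
    obtain ⟨s, hs, hsP⟩ := ih
    obtain ⟨x, hx, hxP⟩ := hP j
    exact ⟨x * s, SetLike.GradedMul.mul_mem hx hs,
      fun h => (Ideal.IsPrime.mem_or_mem ‹_› h).elim hxP hsP⟩

lemma IsStandard.exists_mem_notMem (hS : IsStandard 𝒮) {P : PrimeSpectrum S}
    (hP : P ∈ projSet 𝒮) (n : Fin d → ℕ) : ∃ s ∈ 𝒮 n, s ∉ P.asIdeal := by
  refine exists_mem_notMem_of_forall_single (fun j => ?_) n
  by_contra! hj
  refine hP.2 ?_
  have hle : plusPlus 𝒮 ≤ P.asIdeal.restrictScalars A := by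
    refine iSup₂_le fun n hn s hs => ?_
    have h₁ : degreeIdeal 𝒮 j ≤ P.asIdeal := Ideal.span_le.2 hj
    have h₂ : ∏ i, degreeIdeal 𝒮 i ^ n i ≤ degreeIdeal 𝒮 j ^ n j :=
      Ideal.prod_le_inf.trans (Finset.inf_le (Finset.mem_univ j))
    exact h₁ (Ideal.pow_le_self (Nat.one_le_iff_ne_zero.1 (hn j))
      (h₂ (hS.mem_prod_degreeIdeal_pow hs)))
  exact hle

/-- The radical of a homogeneous ideal is the intersection of the homogeneous primes above it, as
soon as the monoid of degrees can be linearly ordered. -/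
lemma mem_radical_of_forall_homogeneous_prime_of_equiv {ι : Type*} [AddCommMonoid ι]
    [LinearOrder ι] [IsOrderedCancelAddMonoid ι] (φ : ι ≃+ (Fin d → ℕ)) {I : Ideal S}
    (hI : I.IsHomogeneous 𝒮) {y : S}
    (hy : ∀ Q : Ideal S, Q.IsPrime → Q.IsHomogeneous 𝒮 → I ≤ Q → y ∈ Q) : y ∈ I.radical := by
  let 𝒮' : ι → Submodule A S := fun i => 𝒮 (φ i)
  have hint : IsInternal 𝒮' := by
    refine isInternal_submodule_of_iSupIndep_of_iSup_eq_top ?_ ?_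
    · exact (Decomposition.isInternal 𝒮).submodule_iSupIndep.comp φ.injective
    · rw [← (Decomposition.isInternal 𝒮).submodule_iSup_eq_top]
      exact φ.toEquiv.iSup_comp (g := 𝒮)
  let _ : Decomposition 𝒮' := hint.chooseDecomposition
  have : SetLike.GradedMonoid 𝒮' :=
    { one_mem := by
        change (1 : S) ∈ 𝒮 (φ 0)
        rw [map_zero]
        exact SetLike.GradedOne.one_mem
      mul_mem := fun i j a b ha hb => by
        change a * b ∈ 𝒮 (φ (i + j))
        rw [map_add]
        exact SetLike.GradedMul.mul_mem ha hb }
  let _ : GradedRing 𝒮' := { }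
  have hdec : ∀ (s : S) (i : ι), (decompose 𝒮' s i : S) = decompose 𝒮 s (φ i) := by
    intro s i
    induction s using Decomposition.inductionOn 𝒮' with
    | zero => simp
    | @homogeneous k s =>
      rcases eq_or_ne k i with rfl | hik
      · rw [decompose_of_mem_same 𝒮' s.2, decompose_of_mem_same 𝒮 s.2]
      · rw [decompose_of_mem_ne 𝒮' s.2 hik,
          decompose_of_mem_ne 𝒮 s.2 (fun h => hik (φ.injective h))]
    | add s s' h h' => simp [h, h']
  have hhom : ∀ Q : Ideal S, Q.IsHomogeneous 𝒮' ↔ Q.IsHomogeneous 𝒮 := by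
    intro Q
    constructor
    · intro hQ n s hs
      have := hQ (φ.symm n) hs
      rwa [hdec, φ.apply_symm_apply] at this
    · intro hQ i s hs
      rw [hdec]
      exact hQ (φ i) hs
  rw [Ideal.IsHomogeneous.radical_eq ((hhom I).2 hI), Ideal.mem_sInf]
  rintro Q ⟨hQ, hIQ, hprime⟩
  exact hy Q hprime ((hhom Q).1 hQ) hIQ

/-- The criterion for membership in the radical, with the multidegrees ordered lexicographically:
the radical theorem of Mathlib is for gradings by a linearly ordered monoid. -/
lemma mem_radical_of_forall_homogeneous_prime {I : Ideal S} (hI : I.IsHomogeneous 𝒮) {y : S}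
    (hy : ∀ Q : Ideal S, Q.IsPrime → Q.IsHomogeneous 𝒮 → I ≤ Q → y ∈ Q) : y ∈ I.radical :=
  mem_radical_of_forall_homogeneous_prime_of_equiv
    (φ := ofLexAddEquiv (Fin d → ℕ)) hI hy

variable {M : Type*} [AddCommGroup M] [Module S M] [Module A M] [IsScalarTower A S M]
  {ℳ : (Fin d → ℕ) → Submodule A M} [Decomposition ℳ] [SetLike.GradedSMul 𝒮 ℳ]

/-- A prime in the support contains the annihilator of a homogeneous element. -/
lemma exists_homogeneous_smul_eq_zero_imp {P : PrimeSpectrum S} (hP : P ∈ Module.support S M) :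
    ∃ v, ∃ m ∈ ℳ v, ∀ s : S, s • m = 0 → s ∈ P.asIdeal := by
  classical
  obtain ⟨m, hm⟩ := Module.mem_support_iff_exists_annihilator.1 hP
  by_contra! h
  choose s hs hsP using fun v => h v (decompose ℳ m v) (decompose ℳ m v).2
  -- elements outside `P` annihilating the components of `m` would give a product annihilating `m`
  have hprod : (∏ v ∈ (decompose ℳ m).support, s v) • m = 0 := by
    generalize hp : ∏ v ∈ (decompose ℳ m).support, s v = p
    rw [← sum_support_decompose ℳ m, Finset.smul_sum, ← hp]
    refine Finset.sum_eq_zero fun v hv => ?_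
    rw [← Finset.prod_erase_mul _ _ hv, mul_smul, hs, smul_zero]
  obtain ⟨v, _, hv⟩ := (Ideal.IsPrime.prod_mem_iff (p := P.asIdeal)).1
    (hm ((Submodule.mem_annihilator_span_singleton _ _).2 hprod))
  exact hsP v hv

lemma length_le_length_of_ker_le {X Y Z : Type*} [AddCommGroup X] [AddCommGroup Y]
    [AddCommGroup Z] [Module A X] [Module A Y] [Module A Z] {f : X →ₗ[A] Y} {g : X →ₗ[A] Z}
    (hg : Function.Surjective g) (h : LinearMap.ker f ≤ LinearMap.ker g) :
    Module.length A Z ≤ Module.length A Y := by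
  refine (Module.length_le_of_surjective ((LinearMap.ker f).liftQ g h) ?_).trans
    (f.quotKerEquivRange.length_eq.le.trans
      (Module.length_le_of_injective (LinearMap.range f).subtype (Submodule.subtype_injective _)))
  intro z
  obtain ⟨x, rfl⟩ := hg z
  exact ⟨Submodule.Quotient.mk x, rfl⟩

lemma length_add_one_le_of_injective {X Y : Type*} [AddCommGroup X] [AddCommGroup Y]
    [Module A X] [Module A Y] {f : X →ₗ[A] Y} (hf : Function.Injective f)
    (hne : LinearMap.range f ≠ ⊤) : Module.length A X + 1 ≤ Module.length A Y := by
  rw [Module.length_eq_add_of_exact (LinearMap.range f).subtype (LinearMap.range f).mkQ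
    (Submodule.subtype_injective _) (Submodule.mkQ_surjective _)
    (LinearMap.exact_subtype_mkQ (LinearMap.range f)), (LinearEquiv.ofInjective f hf).length_eq]
  gcongr
  have := Submodule.Quotient.nontrivial_iff.2 hne
  exact Order.one_le_iff_pos.2 Module.length_pos

/-- A prime in the support of `M` gives a shifted copy of `S/P` as a subquotient of `M`. -/
lemma exists_length_quotientGrading_le {P : PrimeSpectrum S} (hP : P ∈ Module.support S M) :
    ∃ v, ∀ n, Module.length A (quotientGrading 𝒮 P.asIdeal n) ≤ Module.length A (ℳ (n + v)) := by
  obtain ⟨v, m, hm, hmP⟩ := exists_homogeneous_smul_eq_zero_imp (ℳ := ℳ) hP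
  refine ⟨v, fun n => ?_⟩
  let f : 𝒮 n →ₗ[A] ℳ (n + v) :=
    ((LinearMap.toSpanSingleton S M m).restrictScalars A).restrict
      fun s hs => smul_mem_graded hs hm
  refine length_le_length_of_ker_le (f := f)
    (gradedMap_surjective (ℳ := 𝒮) (f := P.asIdeal.mkQ) n) fun s hs => ?_
  have hs' : (s : S) • m = 0 := congrArg Subtype.val (LinearMap.mem_ker.1 hs)
  exact Subtype.ext ((Submodule.Quotient.mk_eq_zero _).2 (hmP s hs'))

lemma IsStandard.length_quotientGrading_pos (hS : IsStandard 𝒮) {P : PrimeSpectrum S}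
    (hP : P ∈ projSet 𝒮) (n : Fin d → ℕ) :
    0 < Module.length A (quotientGrading 𝒮 P.asIdeal n) := by
  rw [Module.length_pos_iff]
  obtain ⟨s, hs, hsP⟩ := hS.exists_mem_notMem hP n
  refine ⟨⟨⟨P.asIdeal.mkQ s, mem_quotientGrading_mk 𝒮 hs⟩, 0, fun h => hsP ?_⟩⟩
  exact (Submodule.Quotient.mk_eq_zero _).1 (congrArg Subtype.val h)

/-- For `P < Q` in `Proj S`, multiplication by a homogeneous element of `Q` outside `P` is injective
but not surjective on the components of `S/P`. -/
lemma IsStandard.exists_length_add_one_le (hS : IsStandard 𝒮) {P Q : PrimeSpectrum S}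
    (hQ : Q ∈ projSet 𝒮) (hPQ : P < Q) :
    ∃ b, ∀ n, Module.length A (quotientGrading 𝒮 P.asIdeal n) + 1 ≤
      Module.length A (quotientGrading 𝒮 P.asIdeal (b + n)) := by
  classical
  obtain ⟨y, hyQ, hyP⟩ := SetLike.exists_of_lt ((PrimeSpectrum.asIdeal_lt_asIdeal P Q).2 hPQ)
  obtain ⟨b, hb⟩ : ∃ b, (decompose 𝒮 y b : S) ∉ P.asIdeal := by
    by_contra! h
    refine hyP ?_
    rw [← sum_support_decompose 𝒮 y]
    exact sum_mem fun b _ => h b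
  set f : S := (decompose 𝒮 y b : S)
  have hfb : f ∈ 𝒮 b := (decompose 𝒮 y b).2
  have hfQ : f ∈ Q.asIdeal := hQ.1 b hyQ
  refine ⟨b, fun n => ?_⟩
  have := gradedSMul_quotientGrading 𝒮 𝒮 P.asIdeal
  let μ := gradedMul (ℳ := quotientGrading 𝒮 P.asIdeal) hfb n
  have hμ : Function.Injective μ := by
    refine (injective_iff_map_eq_zero _).2 ?_
    rintro ⟨_, s, hs, rfl⟩ hm
    have h : P.asIdeal.mkQ (f • s) = 0 := congrArg Subtype.val hm
    rw [Submodule.mkQ_apply, Submodule.Quotient.mk_eq_zero, smul_eq_mul] at h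
    exact Subtype.ext ((Submodule.Quotient.mk_eq_zero _).2
      ((P.isPrime.mem_or_mem h).resolve_left hb))
  obtain ⟨s, hs, hsQ⟩ := hS.exists_mem_notMem hQ (b + n)
  have hne : LinearMap.range μ ≠ ⊤ := by
    intro htop
    have : (⟨P.asIdeal.mkQ s, mem_quotientGrading_mk 𝒮 hs⟩ :
        quotientGrading 𝒮 P.asIdeal (b + n)) ∈ LinearMap.range μ := htop ▸ trivial
    obtain ⟨⟨_, r, hr, rfl⟩, h⟩ := this
    have h' : P.asIdeal.mkQ (f • r) = P.asIdeal.mkQ s := congrArg Subtype.val h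
    rw [← sub_eq_zero, ← map_sub, Submodule.mkQ_apply, Submodule.Quotient.mk_eq_zero] at h'
    have h₁ : f • r - s ∈ Q.asIdeal := hPQ.le h'
    have h₂ : f • r ∈ Q.asIdeal := Ideal.mul_mem_right _ _ hfQ
    exact hsQ ((Submodule.sub_mem_iff_right _ h₂).1 h₁)
  exact length_add_one_le_of_injective hμ hne

variable [IsArtinianRing A] [Module.Finite S M]

/-- If `Supp_{++} M` is empty, the product of the ideals `S_{e_j} S` lies in the radical of the
annihilator of `M`, so a power of it annihilates `M`; and in large degrees every element of `M` is in
the multiple of `M` by that power. -/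
lemma IsStandard.eventually_eq_bot (hS : IsStandard 𝒮) (hempty : suppPlusPlus 𝒮 M = ∅) :
    ∀ᶠ n in atTop, ℳ n = ⊥ := by
  have hnoeth : IsNoetherianRing S :=
    have := hS.1
    Algebra.FiniteType.isNoetherianRing A S
  set J : Ideal S := ∏ j, degreeIdeal 𝒮 j with hJ
  have hJrad : J ≤ (Module.annihilator S M).radical := by
    intro y hy
    refine mem_radical_of_forall_homogeneous_prime (isHomogeneous_annihilator (𝒮 := 𝒮) ℳ)
      fun Q hQ hQhom hQann => ?_
    by_contra hyQ
    have hsupp : (⟨Q, hQ⟩ : PrimeSpectrum S) ∈ Module.support S M :=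
      Module.mem_support_iff_of_finite.2 hQann
    have hsub : (plusPlus 𝒮 : Set S) ⊆ Q := by
      by_contra hsub
      have : (⟨Q, hQ⟩ : PrimeSpectrum S) ∈ suppPlusPlus 𝒮 M := ⟨⟨hQhom, hsub⟩, hsupp⟩
      rw [hempty] at this
      exact this
    obtain ⟨s, hs, hsQ⟩ : ∃ s ∈ 𝒮 1, s ∉ Q := by
      refine exists_mem_notMem_of_forall_single (fun j => ?_) 1
      by_contra! hj
      have h₁ : degreeIdeal 𝒮 j ≤ Q := Ideal.span_le.2 hj
      exact hyQ (h₁ ((Ideal.prod_le_inf.trans (Finset.inf_le (Finset.mem_univ j))) hy))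
    exact hsQ (hsub (Submodule.mem_iSup_of_mem 1 (Submodule.mem_iSup_of_mem le_rfl hs)))
  obtain ⟨r, hr⟩ := Ideal.exists_pow_le_of_le_radical_of_fg hJrad (IsNoetherian.noetherian J)
  obtain ⟨G, hG, hGhom⟩ := exists_finset_homogeneous_span (S := S) (ℳ := ℳ)
  choose! v hv using hGhom
  refine eventually_atTop.2 ⟨G.sup v + fun _ => r, fun n hn => ?_⟩
  rw [eq_bot_iff]
  intro m hm
  have hspan : m ∈ Submodule.span S (G : Set M) := hG ▸ trivial
  obtain ⟨s, -, hs⟩ := Submodule.mem_span_finset.1 hspan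
  rw [Submodule.mem_bot, ← decompose_of_mem_same ℳ hm, ← hs, decompose_sum,
    DFinsupp.finsetSum_apply, AddSubmonoidClass.coe_finsetSum]
  refine Finset.sum_eq_zero fun g hg => ?_
  have hvg : v g + (fun _ => r) ≤ n := (add_le_add_left (Finset.le_sup hg) _).trans hn
  obtain ⟨u, rfl⟩ := exists_add_of_le (le_self_add.trans hvg)
  have hu : ∀ j, r ≤ u j := fun j => by simpa using hvg j
  rw [add_comm, decompose_smul_of_right (𝒮 := 𝒮) (hv g hg)]
  refine Module.mem_annihilator.1 (hr ?_) g
  have hle : ∏ j, degreeIdeal 𝒮 j ^ u j ≤ J ^ r := by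
    rw [hJ, ← Finset.prod_pow]
    exact Finset.prod_le_prod' fun j _ => Ideal.pow_le_pow_right (hu j)
  exact hle (hS.mem_prod_degreeIdeal_pow (decompose 𝒮 (s g) u).2)

/-- When the Hilbert function of `M` is eventually constant, it is nonzero exactly if the
support has dimension zero. -/
lemma IsStandard.ne_zero_iff_dimSuppPlusPlus_eq_zero (hS : IsStandard 𝒮) {c : ℤ}
    (hc : ∀ᶠ n in atTop, hilbertFun ℳ n = c) :
    c ≠ 0 ↔ dimSuppPlusPlus 𝒮 M = 0 := by
  have hlen : ∀ᶠ n in atTop, Module.length A (ℳ n) = (c.toNat : ℕ∞) := by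
    filter_upwards [hc] with n hn
    rw [← hn, hilbertFun, Int.toNat_natCast, ENat.natCast_toNat (hS.length_ne_top ℳ n)]
  obtain ⟨a, ha⟩ := eventually_atTop.1 hlen
  have hnonempty : c ≠ 0 ↔ (suppPlusPlus 𝒮 M).Nonempty := by
    constructor
    · intro hc0
      by_contra hne
      obtain ⟨n, hn, hn'⟩ :=
        (hc.and (hS.eventually_eq_bot (ℳ := ℳ) (Set.not_nonempty_iff_eq_empty.1 hne))).exists
      rw [hilbertFun, hn', Module.length_bot] at hn
      exact hc0 hn.symm
    · rintro ⟨P, hP⟩ rfl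
      obtain ⟨v, hv⟩ := exists_length_quotientGrading_le (𝒮 := 𝒮) (ℳ := ℳ) hP.2
      have h := (hS.length_quotientGrading_pos hP.1 a).trans_le (hv a)
      rw [ha _ le_self_add] at h
      simp at h
  have hchain : ∀ P ∈ suppPlusPlus 𝒮 M, ∀ Q ∈ suppPlusPlus 𝒮 M, ¬ P < Q := by
    intro P hP Q hQ hPQ
    obtain ⟨v, hv⟩ := exists_length_quotientGrading_le (𝒮 := 𝒮) (ℳ := ℳ) hP.2
    obtain ⟨b, hb⟩ := hS.exists_length_add_one_le hQ.1 hPQ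
    -- `b` may be zero here; the growth of the lengths is contradictory in any case
    have hgrow : ∀ r : ℕ, (r : ℕ∞) ≤
        Module.length A (quotientGrading 𝒮 P.asIdeal (r • b + a)) := by
      intro r
      induction r with
      | zero => simp
      | succ r ih =>
        rw [succ_nsmul', add_assoc, Nat.cast_add, Nat.cast_one]
        exact (add_le_add_left ih 1).trans (hb _)
    have h := (hgrow (c.toNat + 1)).trans (hv _)
    rw [ha _ (le_add_self.trans le_self_add), Nat.cast_le] at h
    omega
  rw [hnonempty]
  constructor
  · intro hne
    have := hne.to_subtype
    refine le_antisymm ?_ Order.krullDim_nonneg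
    rw [dimSuppPlusPlus, Order.krullDim_nonpos_iff_forall_isMax]
    rintro ⟨P, hP⟩ ⟨Q, hQ⟩ hle
    by_contra hlt
    exact hchain P hP Q hQ (lt_of_le_not_ge hle hlt)
  · intro hdim
    by_contra hne
    have : IsEmpty (suppPlusPlus 𝒮 M) :=
      Set.isEmpty_coe_sort.2 (Set.not_nonempty_iff_eq_empty.1 hne)
    rw [dimSuppPlusPlus, Order.krullDim_eq_bot] at hdim
    exact absurd hdim (by simp)

end Support

end MixedMult

/-! ### Mixed multiplicities and filter-regular sequences -/

theorem mainTheorem2 {d : ℕ} (hd : 0 < d)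
    {A : Type*} [CommRing A] [IsLocalRing A] [IsArtinianRing A]
    {S : Type*} [CommRing S] [Algebra A S]
    (𝒮 : (Fin d → ℕ) → Submodule A S) [GradedAlgebra 𝒮] (hS : MixedMult.IsStandard 𝒮)
    {M : Type*} [AddCommGroup M] [Module S M] [Module A M] [IsScalarTower A S M]
    [Module.Finite S M]
    (ℳ : (Fin d → ℕ) → Submodule A M) [DirectSum.Decomposition ℳ] [SetLike.GradedSMul 𝒮 ℳ] :
    MixedMult.IsHilbertPolynomial ℳ (MixedMult.hilbertPolynomial ℳ) ∧
    MixedMult.IsBinomialExpansion (MixedMult.hilbertPolynomial ℳ) (MixedMult.mixedCoeff ℳ) ∧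
    ∀ (k : Fin d → ℕ), MixedMult.IsMixedMultiplicityDefined ℳ k →
      ∀ {t : ℕ} (x : Fin t → S), MixedMult.IsOfType 𝒮 k x →
        MixedMult.IsFilterRegularSequence 𝒮 ℳ x →
        (∀ᶠ n : Fin d → ℕ in atTop, ∃ l : ℕ,
          Module.length A
            (MixedMult.quotientGrading ℳ (MixedMult.spanSMul M (Set.range x)) n) = l ∧
          MixedMult.mixedCoeff ℳ k = l) ∧
        (MixedMult.mixedCoeff ℳ k ≠ 0 ↔
          MixedMult.dimSuppPlusPlus 𝒮 (M ⧸ MixedMult.spanSMul M (Set.range x)) = 0) := by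
  obtain ⟨hP, he⟩ := hS.isHilbertPolynomial_and_isBinomialExpansion ℳ
  refine ⟨hP, he, fun k hk t x hx hreg => ?_⟩
  obtain ⟨hhom, hev⟩ := MixedMult.eventually_hilbertFun_filterRegularSequence hx hreg
    (hS.length_ne_top ℳ) (hS.eventually_hilbertFun_eq ℳ)
  set N := MixedMult.spanSMul M (Set.range x)
  obtain ⟨_⟩ := MixedMult.nonempty_decomposition_quotientGrading ℳ hhom
  have := MixedMult.gradedSMul_quotientGrading ℳ 𝒮 N
  -- the coefficients above `k` vanish, so only the constant term survives the translation by `k`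
  have hshift : MixedMult.coeffShift k (MixedMult.mixedCoeff ℳ) =
      Finsupp.single 0 (MixedMult.mixedCoeff ℳ k) := by
    ext h
    rw [MixedMult.coeffShift_apply, Finsupp.single_apply]
    split_ifs with h0
    · rw [← h0, zero_add]
    · exact hk _ (lt_of_le_of_ne le_add_self fun hkh => h0 (right_eq_add.1 hkh).symm)
  have hconst : ∀ᶠ n in atTop,
      MixedMult.hilbertFun (MixedMult.quotientGrading ℳ N) n = MixedMult.mixedCoeff ℳ k := by
    filter_upwards [hev] with n hn
    rw [hn, hshift, MixedMult.binomialSum_single, MixedMult.binomialFun_zero, mul_one]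
  refine ⟨?_, hS.ne_zero_iff_dimSuppPlusPlus_eq_zero hconst⟩
  filter_upwards [hconst] with n hn
  exact ⟨_, (ENat.natCast_toNat (hS.length_ne_top (MixedMult.quotientGrading ℳ N) n)).symm, hn.symm⟩
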